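/- Fix a set $\mathscr V$ of term variables and a non-empty set $\mathscr X$ of type variables. Positions are finite sequences of non-negative integers; $\bar a$ is obtained from $a$ by replacing every integer $\geqslant 3$ by $2$. **Terms.** $\Lambda^{111}$ is the set of finite or infinite $\lambda$-terms $t,u::=x\mid\lambda x.t\mid t\,u$ (coinductively), seen as labelled trees ($\lambda x$ has the child $0$; an application $@$ has the children $1$ (left) and $2$ (argument)). $\Lambda^{001}$ is the set of those terms all of whose infinite branches go infinitely often through the argument of an application. A normal form is a term without any subterm $(\lambda x.r)s$. **Types.** Types are given coinductively by $T::=\alpha\mid (T_k)_{k\in K}\to T$ with $\alpha\in\mathscr X$ and $K\subseteq\mathbb N\setminus\{0,1\}$. In the labelled tree of $(T_k)_{k\in K}\to T$, the root is $\to$, $T$ is at child $1$ and $T_k$ at child $k$; infinite branches ending by $1^\omega$ are forbidden. A family $F=(T_k)_{k\in K}$ is a sequence type with set of roots $K$; $(\,)$ is the empty one and $k\cdot T$ the one with only $T$, on track $k$. The join of sequence types is defined when their sets of roots are pairwise disjoint and is then their union. A context maps variables to sequence types; joins of contexts are pointwise. **Derivations.** A derivation $P$ typing $t$ is a finite or infinite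 tree of judgments with support $A$ ($\varepsilon\in A$, $A$ closed under prefixes), the judgment at $a\in A$ being $C(a)\vdash t|_{\bar a}:T(a)$, such that each node is an instance of one of the following rules (the premises of the node at $a$ being at positions $a\cdot\ell$): * (ax) $x:k\cdot T\vdash x:T$, with $k\geqslant 2$ (its axiom track) and no premise; * (abs) from $C\vdash t:T$ (at $0$) infer $C-x\vdash\lambda x.t:C(x)\to T$, where $C-x$ is $C$ with $x$ reset to $(\,)$; * (app) from $C\vdash t:(S_k)_{k\in K}\to T$ (at $1$) and $D_k\vdash u:S_k$ (at $k$, for each $k\in K$) infer $C\cup\bigcup_{k\in K}D_k\vdash t\,u:T$, where the contexts are pairwise disjoint. **Approximability.** The bisupport of $P$ is the set of all $(a,c)$ with $a\in A$ and $c$ a position of $T(a)$, and all $(a,x,c)$ with $a\in A$ and $c$ a position of $C(a)(x)$; each of them points at a type symbol of $P$. A derivation $P_0$ typing the same term is an approximation of $P$ if its bisupport is contained in that of $P$, with the same symbols. $P$ is *approximable* if every finite subset of its bisupport is contained in the bisupport of some approximation of $P$ whose bisupport is finite. **Quantitativity.** $P$ is *quantitative* if, for all $a\in A$ and $x\in\mathscr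 V$, $C(a)(x)$ is the join of the $k'\cdot T(a')$, where $a'$ ranges over the axiom leaves of $P$ above $a$ that type an occurrence of $x$ free in $t|_{\bar a}$, and $k'$ is the axiom track of $a'$. **Unforgetfulness.** The sets $\mathrm{EFO}^{+}$ and $\mathrm{EFO}^-$ of positive and negative occurrences of $(\,)$ are defined by $\mathrm{EFO}^\pm(\alpha)=\emptyset$; $\mathrm{EFO}^{+}((\,)\to T)=1\cdot\mathrm{EFO}^{+}(T)$; $\mathrm{EFO}^{-}((\,)\to T)=\{\varepsilon\}\cup 1\cdot\mathrm{EFO}^{-}(T)$; $\mathrm{EFO}^\pm(F\to T)=\mathrm{EFO}^\mp(F)\cup1\cdot\mathrm{EFO}^\pm(T)$ if $F\neq(\,)$; and $\mathrm{EFO}^\pm((T_k)_{k\in K})=\bigcup_{k\in K}k\cdot\mathrm{EFO}^\pm(T_k)$. $P$, with conclusion $C\vdash t:T$, is *unforgetful* if $\mathrm{EFO}^-(C(x))=\emptyset$ for all $x\in\mathscr V$ and $\mathrm{EFO}^+(T)=\emptyset$. **Claim.** Let $t\in\Lambda^{001}$ be a normal form. Then 1. there is a derivation typing $t$ that is both approximable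 and unforgetful; 2. every quantitative derivation typing $t$ is approximable. -/

import Mathlib

namespace RigidTyping

/-! ### Positions

Positions are finite sequences of non-negative integers (tracks), read from the root. -/

/-- Argument tracks: the integers `≥ 2`. -/
abbrev ArgTrack := {k : ℕ // 2 ≤ k}

/-- The collapse of a position: every track `≥ 3` is replaced by `2`. -/
def collapse (a : List ℕ) : List ℕ := a.map (fun k => min k 2)

/-! ### Infinitary terms -/

/-- Node labels of terms: `x`, `λx`, `@`. -/
inductive TermLabel (V : Type*) where
  | var (x : V)
  | lam (x : V)
  | app

/-- Finite or infinite λ-terms (the coinductive grammar `t, u ::= x | λx.t | t u`), as labelled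
trees: a node `λx` has the only child `0`, a node `@` has the two children `1` (left) and
`2` (argument), a variable is a leaf. -/
structure Term (V : Type*) where
  label : List ℕ → Option (TermLabel V)
  root : label [] ≠ none
  child : ∀ (b : List ℕ) (k : ℕ), label (b ++ [k]) ≠ none ↔
    ((∃ x, label b = some (TermLabel.lam x)) ∧ k = 0) ∨
      (label b = some TermLabel.app ∧ (k = 1 ∨ k = 2))

namespace Term

variable {V : Type*}

/-- `s` is an infinite branch of `t`: all its finite prefixes are positions of `t`. -/
def IsInfiniteBranch (t : Term V) (s : ℕ → ℕ) : Prop :=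
  ∀ n : ℕ, t.label ((List.range n).map s) ≠ none

/-- Membership in the calculus `Λ^001`: every infinite branch visits infinitely many
application arguments. -/
def Is001 (t : Term V) : Prop :=
  ∀ s : ℕ → ℕ, t.IsInfiniteBranch s → {i : ℕ | 2 ≤ s i}.Infinite

/-- Normal forms: no position `b` carries a redex `(λx.r) s`. -/
def IsNormal (t : Term V) : Prop :=
  ¬ ∃ (b : List ℕ) (x : V), t.label b = some TermLabel.app ∧
      t.label (b ++ [1]) = some (TermLabel.lam x)

end Term

/-! ### Rigid types -/

/-- Node labels of types: a type variable or `→`. -/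
inductive TyLabel (X : Type*) where
  | var (α : X)
  | arrow

/-- Rigid types (the coinductive grammar `T ::= α | (T_k)_{k ∈ K} → T`, `K ⊆ ℕ ∖ {0, 1}`) without
infinite branch ending by `1^ω`, as labelled trees: an arrow has its target as child `1` and the
members of its source as children `k ≥ 2`; a type variable is a leaf. -/
@[ext] structure Ty (X : Type*) where
  label : List ℕ → Option (TyLabel X)
  root : label [] ≠ none
  child : ∀ (c : List ℕ) (k : ℕ), label (c ++ [k]) ≠ none → label c = some TyLabel.arrow ∧ 1 ≤ k
  target : ∀ c : List ℕ, label c = some TyLabel.arrow → label (c ++ [1]) ≠ none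
  no_ones : ∀ c : List ℕ, ∃ n : ℕ, label (c ++ List.replicate n 1) = none

/-- Sequence types: families `(T_k)_{k ∈ K}` of types with `K ⊆ ℕ ∖ {0, 1}`. -/
def SeqTy (X : Type*) := ArgTrack → Option (Ty X)

namespace SeqTy

variable {X : Type*}

/-- The set `K` of roots of `(T_k)_{k ∈ K}`. -/
def roots (F : SeqTy X) : Set ArgTrack := {k | F k ≠ none}

/-- The empty sequence type `()`. -/
def empty : SeqTy X := fun _ => none

/-- The sequence type `k · T`. -/
def single (k : ArgTrack) (T : Ty X) : SeqTy X := fun j => if j = k then some T else none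

/-- The symbol of `F` at a position: `F (k · c) = T_k (c)`. -/
def label (F : SeqTy X) : List ℕ → Option (TyLabel X)
  | [] => none
  | k :: c => if h : 2 ≤ k then (F ⟨k, h⟩).bind (fun T => T.label c) else none

/-- `F` is the join of the family `G`; this includes that the family is disjoint. -/
def IsJoin {ι : Type*} (G : ι → SeqTy X) (F : SeqTy X) : Prop :=
  (∀ i j : ι, i ≠ j → Disjoint (G i).roots (G j).roots) ∧
    ∀ (k : ArgTrack) (T : Ty X), F k = some T ↔ ∃ i, G i k = some T

end SeqTy

namespace Ty

variable {X : Type*}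

/-- The type variable `α`, as a type. -/
def var (α : X) : Ty X where
  label c := if c = [] then some (TyLabel.var α) else none
  root := by simp
  child := by simp
  target := by intro c; split_ifs <;> simp
  no_ones := fun c => ⟨1, by simp⟩

/-- The labelled tree of `F → T`. -/
def arrowLabel (F : SeqTy X) (T : Ty X) : List ℕ → Option (TyLabel X)
  | [] => some TyLabel.arrow
  | k :: c => if k = 1 then T.label c else F.label (k :: c)

/-- The type `F → T`. -/
def arrow (F : SeqTy X) (T : Ty X) : Ty X where
  label := arrowLabel F T
  root := by simp [arrowLabel]
  child := by
    rintro (_ | ⟨j, c⟩) k h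
    · refine ⟨rfl, ?_⟩
      by_contra hk
      have hk0 : k = 0 := by omega
      subst hk0
      simp [arrowLabel, SeqTy.label] at h
    · by_cases hj : j = 1
      · subst hj
        exact T.child c k (by simpa [arrowLabel] using h)
      · by_cases h2 : 2 ≤ j
        · cases hF : F ⟨j, h2⟩ with
          | none => simp [arrowLabel, SeqTy.label, hj, h2, hF] at h
          | some S =>
            have := S.child c k (by simpa [arrowLabel, SeqTy.label, hj, h2, hF] using h)
            simpa [arrowLabel, SeqTy.label, hj, h2, hF] using this
        · simp [arrowLabel, SeqTy.label, hj, h2] at h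
  target := by
    rintro (_ | ⟨j, c⟩) h
    · simpa [arrowLabel] using T.root
    · by_cases hj : j = 1
      · subst hj
        simpa [arrowLabel] using T.target c (by simpa [arrowLabel] using h)
      · by_cases h2 : 2 ≤ j
        · cases hF : F ⟨j, h2⟩ with
          | none => simp [arrowLabel, SeqTy.label, hj, h2, hF] at h
          | some S =>
            have := S.target c (by simpa [arrowLabel, SeqTy.label, hj, h2, hF] using h)
            simpa [arrowLabel, SeqTy.label, hj, h2, hF] using this
        · simp [arrowLabel, SeqTy.label, hj, h2] at h
  no_ones := by
    rintro (_ | ⟨j, c⟩)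
    · obtain ⟨n, hn⟩ := T.no_ones []
      exact ⟨n + 1, by simpa [arrowLabel, List.replicate_succ] using hn⟩
    · by_cases hj : j = 1
      · subst hj
        obtain ⟨n, hn⟩ := T.no_ones c
        exact ⟨n, by simpa [arrowLabel] using hn⟩
      · by_cases h2 : 2 ≤ j
        · cases hF : F ⟨j, h2⟩ with
          | none => exact ⟨0, by simp [arrowLabel, SeqTy.label, hj, h2, hF]⟩
          | some S =>
            obtain ⟨n, hn⟩ := S.no_ones c
            exact ⟨n, by simpa [arrowLabel, SeqTy.label, hj, h2, hF] using hn⟩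
        · exact ⟨0, by simp [arrowLabel, SeqTy.label, hj, h2]⟩

end Ty

/-! ### Contexts and rigid derivations -/

/-- Contexts: functions from term variables to sequence types. -/
def Ctx (V X : Type*) := V → SeqTy X

namespace Ctx

variable {V X : Type*}

open Classical in
/-- The context `x : k · T`. -/
noncomputable def single (x : V) (k : ArgTrack) (T : Ty X) : Ctx V X :=
  fun y => if y = x then SeqTy.single k T else SeqTy.empty

open Classical in
/-- The context `C - x`. -/
noncomputable def erase (C : Ctx V X) (x : V) : Ctx V X :=
  fun y => if y = x then SeqTy.empty else C y

end Ctx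

/-- Correctness, at position `a`, of the labelled tree of judgments with support `A` whose
judgment at `a` is `C a ⊢ t|_{collapse a} : T a`. The three cases are the rules `ax`, `abs`
and `app`. -/
def RuleAt {V X : Type*} (t : Term V) (A : Set (List ℕ)) (C : List ℕ → Ctx V X)
    (T : List ℕ → Ty X) (a : List ℕ) : Prop :=
  match t.label (collapse a) with
  | none => False
  | some (TermLabel.var x) =>
      (∀ k : ℕ, a ++ [k] ∉ A) ∧
      ∃ k : ArgTrack, C a = Ctx.single x k (T a)
  | some (TermLabel.lam x) =>
      (∀ k : ℕ, a ++ [k] ∈ A ↔ k = 0) ∧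
      C a = (C (a ++ [0])).erase x ∧
      T a = Ty.arrow (C (a ++ [0]) x) (T (a ++ [0]))
  | some TermLabel.app =>
      a ++ [0] ∉ A ∧ a ++ [1] ∈ A ∧
      (∃ S : SeqTy X, T (a ++ [1]) = Ty.arrow S (T a) ∧
        ∀ (k : ArgTrack) (U : Ty X),
          S k = some U ↔ a ++ [k.1] ∈ A ∧ T (a ++ [k.1]) = U) ∧
      ∀ x : V, SeqTy.IsJoin
        (fun l : {l : ℕ // a ++ [l] ∈ A} => C (a ++ [l.1]) x) (C a x)

/-- Rigid derivations typing `t`: the (possibly infinite) trees of judgments that are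
everywhere correct. The values of `ctx` and `ty` outside `supp` play no role. -/
structure Deriv {V : Type*} (X : Type*) (t : Term V) where
  supp : Set (List ℕ)
  ctx : List ℕ → Ctx V X
  ty : List ℕ → Ty X
  root_mem : [] ∈ supp
  prefix_mem : ∀ (a : List ℕ) (k : ℕ), a ++ [k] ∈ supp → a ∈ supp
  rule : ∀ a ∈ supp, RuleAt t supp ctx ty a

/-- Bipositions: right ones `(a, c)` and left ones `(a, x, c)`. -/
inductive Bipos (V : Type*) where
  | right (a c : List ℕ)
  | left (a : List ℕ) (x : V) (c : List ℕ)

/-- Polarities. -/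
inductive Polarity where
  | pos
  | neg

/-- The opposite polarity. -/
def Polarity.flip : Polarity → Polarity
  | Polarity.pos => Polarity.neg
  | Polarity.neg => Polarity.pos

/-- `Ty.EFO s T c`: the position `c` belongs to `EFO^s(T)`, the empty sequence type `()` being the
source of the arrow that stands at position `c` of `T`, with polarity `s` in `T`. -/
inductive Ty.EFO {X : Type*} : Polarity → Ty X → List ℕ → Prop
  | here (T : Ty X) : Ty.EFO Polarity.neg (Ty.arrow SeqTy.empty T) []
  | target (s : Polarity) (F : SeqTy X) (T : Ty X) (c : List ℕ) :
      Ty.EFO s T c → Ty.EFO s (Ty.arrow F T) (1 :: c)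
  | source (s : Polarity) (F : SeqTy X) (T : Ty X) (k : ArgTrack) (S : Ty X) (c : List ℕ) :
      F k = some S → Ty.EFO s.flip S c → Ty.EFO s (Ty.arrow F T) (k.1 :: c)

/-- `EFO^s` of a sequence type: the union of the `k · EFO^s(T_k)`. -/
def SeqTy.EFO {X : Type*} (s : Polarity) (F : SeqTy X) (c : List ℕ) : Prop :=
  ∃ (k : ArgTrack) (T : Ty X) (d : List ℕ), F k = some T ∧ c = k.1 :: d ∧ Ty.EFO s T d

namespace Deriv

variable {V X : Type*} {t : Term V}

/-- `P(b)`: the type symbol at the biposition `b`. -/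
def label (P : Deriv X t) : Bipos V → Option (TyLabel X)
  | Bipos.right a c => (P.ty a).label c
  | Bipos.left a x c => (P.ctx a x).label c

/-- The bisupport of `P`. -/
def bisupp (P : Deriv X t) : Set (Bipos V) :=
  {b | match b with
    | Bipos.right a c => a ∈ P.supp ∧ (P.ty a).label c ≠ none
    | Bipos.left a x c => a ∈ P.supp ∧ (P.ctx a x).label c ≠ none}

/-- `P₀` is an approximation of `P`. -/
def IsApprox (P₀ P : Deriv X t) : Prop :=
  P₀.bisupp ⊆ P.bisupp ∧ ∀ b ∈ P₀.bisupp, P₀.label b = P.label b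

/-- `P` is approximable: every finite part of its bisupport is contained in a finite
approximation of `P`. -/
def Approximable (P : Deriv X t) : Prop :=
  ∀ B : Set (Bipos V), B.Finite → B ⊆ P.bisupp →
    ∃ P₀ : Deriv X t, P₀.bisupp.Finite ∧ P₀.IsApprox P ∧ B ⊆ P₀.bisupp

/-- The positions of the axiom leaves above `a` that type a free occurrence of `x` in the
subterm at `a` (no `λx` in between). -/
def axPos (P : Deriv X t) (a : List ℕ) (x : V) : Set (List ℕ) :=
  {a' | a' ∈ P.supp ∧ a <+: a' ∧ t.label (collapse a') = some (TermLabel.var x) ∧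
    ∀ d : List ℕ, a <+: d → d <+: a' → t.label (collapse d) ≠ some (TermLabel.lam x)}

/-- `k` is the axiom track of the axiom leaf `a`, which types `x`. -/
def HasAxTrack (P : Deriv X t) (a : List ℕ) (x : V) (k : ArgTrack) : Prop :=
  P.ctx a = Ctx.single x k (P.ty a)

/-- `P` is quantitative: `C(a)(x)` is the join of the `tr(a') · T(a')`, for `a'` ranging over
the axiom leaves above `a` that type `x`. -/
def Quantitative (P : Deriv X t) : Prop :=
  ∀ a ∈ P.supp, ∀ x : V, SeqTy.IsJoin
    (fun p : {p : List ℕ × ArgTrack // p.1 ∈ P.axPos a x ∧ P.HasAxTrack p.1 x p.2} =>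
      SeqTy.single p.1.2 (P.ty p.1.1)) (P.ctx a x)

/-- `P` is unforgetful: in its concluding judgment `C ⊢ t : T`, no `()` occurs negatively in `C`
or positively in `T`. -/
def Unforgetful (P : Deriv X t) : Prop :=
  (∀ (x : V) (c : List ℕ), ¬ SeqTy.EFO Polarity.neg (P.ctx [] x) c) ∧
    ∀ c : List ℕ, ¬ Ty.EFO Polarity.pos (P.ty []) c

end Deriv

end RigidTyping

namespace RigidTyping

/-! ### Trees of positions -/

/-! In a quantitative derivation typing a normal form, most types are forced. At the left child of
an application at `b`, the type is `(T(b·k))_k → T(b)`; at an abstraction `λx` at `a`, it is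
`C(a·0)(x) → T(a·0)`, where contexts are read off the axiom leaves. Normality keeps the two cases
apart. The support, the axiom tracks and the types at the remaining, unconstrained positions
therefore determine everything. These data form a `Skeleton`, and conversely every skeleton yields a
derivation (`Skeleton.toDeriv`). A symbol of the type at `a` is found by a deterministic walk in the
support (`Step`), one move per track, until an unconstrained position supplies the rest. `Is001`
rules out infinitely many nested abstractions, which is what forbids branches `1^ω` in these types.

Derivations from skeletons are approximable. Restrict the support to the positions with at most `n`
argument tracks, all bounded, and truncate the free types in the same way. By König's lemma and
`Is001` the support becomes finite; walks in a finite support terminate, so the bisupport is finite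
too (`finite_bisupp`). A walk to a given symbol visits finitely many positions, hence survives in
every large enough restriction (`eventually_tyLabel_restrict`).

A quantitative derivation agrees on its support with the one rebuilt from its skeleton
(`skeleton_tyLabel`), which gives the second claim. For the first, the skeleton that types each
argument once and assigns a type variable to unconstrained positions is unforgetful by a polarity
invariant (`linearSkeleton_EFO`). -/

theorem collapse_concat (a : List ℕ) (k : ℕ) : collapse (a ++ [k]) = collapse a ++ [min k 2] := by
  simp [collapse]

theorem mem_of_append_mem {A : Set (List ℕ)} (hA : ∀ a k, a ++ [k] ∈ A → a ∈ A) (a b : List ℕ)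
    (h : a ++ b ∈ A) : a ∈ A := by
  induction b using List.reverseRecOn with
  | nil => simpa using h
  | append_singleton b k ih => exact ih (hA _ k (by simpa using h))

theorem mem_of_prefix {A : Set (List ℕ)} (hA : ∀ a k, a ++ [k] ∈ A → a ∈ A) {a b : List ℕ}
    (hab : a <+: b) (h : b ∈ A) : a ∈ A := by
  obtain ⟨c, rfl⟩ := hab
  exact mem_of_append_mem hA a c h

/-- A form of König's lemma. -/
theorem finite_of_no_infinite_branch (D : Set (List ℕ)) (hD : ∀ a k, a ++ [k] ∈ D → a ∈ D)
    (m : ℕ) (hb : ∀ a ∈ D, ∀ k ∈ a, k ≤ m)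
    (hs : ∀ s : ℕ → ℕ, ∃ n, (List.range n).map s ∉ D) : D.Finite := by
  by_contra hinf
  have step : ∀ a : List ℕ, {c | a ++ c ∈ D}.Infinite → ∃ k, {c | (a ++ [k]) ++ c ∈ D}.Infinite := by
    intro a ha
    by_contra! hfin
    refine ha (((Set.finite_singleton []).union ((Set.finite_Iic m).biUnion
      (t := fun k => (List.cons k) '' {c | (a ++ [k]) ++ c ∈ D})
      fun k _ => (hfin k).image _)).subset ?_)
    rintro (_ | ⟨k, c⟩) hc
    · simp
    · right
      simp only [Set.mem_iUnion]
      exact ⟨k, hb _ hc k (by simp), c, by simpa using hc, rfl⟩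
  choose! f hf using step
  let u : ℕ → List ℕ := fun n => Nat.rec [] (fun _ a => a ++ [f a]) n
  have hu : ∀ n, {c | u n ++ c ∈ D}.Infinite := by
    intro n
    induction n with
    | zero => simpa [u] using hinf
    | succ n ih => exact hf _ ih
  obtain ⟨n, hn⟩ := hs (fun n => f (u n))
  have hmap : ∀ n, (List.range n).map (fun n => f (u n)) = u n := by
    intro n
    induction n with
    | zero => rfl
    | succ n ih => rw [List.range_succ, List.map_append, ih]; rfl
  obtain ⟨c, hc⟩ := (hu n).nonempty
  exact hn (hmap n ▸ mem_of_append_mem hD _ c hc)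

/-- Positions with at most `n` argument tracks, all tracks being at most `n + 1`. -/
def Small (n : ℕ) (c : List ℕ) : Prop :=
  (∀ k ∈ c, k ≤ n + 1) ∧ c.countP (fun k => 2 ≤ k) ≤ n

theorem Small.nil (n : ℕ) : Small n [] := by simp [Small]

theorem Small.of_append {n : ℕ} {c d : List ℕ} (h : Small n (c ++ d)) : Small n c := by
  simp only [Small, List.mem_append, List.countP_append] at h ⊢
  exact ⟨fun k hk => h.1 k (Or.inl hk), by omega⟩

/-- The bound `n + 1` on tracks, rather than `n`, admits `0` and `1` even for `n = 0`. Thus cutting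
to small positions only ever removes arguments, never the child of an abstraction, a left child or
the target of an arrow. -/
theorem Small.concat {n : ℕ} {c : List ℕ} (h : Small n c) {k : ℕ} (hk : k ≤ 1) :
    Small n (c ++ [k]) := by
  obtain ⟨h1, h2⟩ := h
  refine ⟨?_, ?_⟩
  · intro j hj
    rcases List.mem_append.1 hj with hj | hj
    · exact h1 j hj
    · simp only [List.mem_singleton] at hj
      omega
  · have : ¬ 2 ≤ k := by omega
    simpa [List.countP_append, this] using h2

theorem eventually_small (c : List ℕ) : ∀ᶠ n in Filter.atTop, Small n c := by
  filter_upwards [Filter.eventually_ge_atTop (c.sum + c.length)] with n hn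
  refine ⟨fun k hk => ?_, List.countP_le_length.trans (by omega)⟩
  have := List.le_sum_of_mem hk
  omega

theorem finite_of_small {n : ℕ} {s : ℕ → ℕ} (h : ∀ m, Small n ((List.range m).map s)) :
    {i | 2 ≤ s i}.Finite := by
  by_contra hinf
  have hcount : ∀ m, ((List.range m).map s).countP (fun k => 2 ≤ k)
      = Nat.count (fun i => 2 ≤ s i) m := by
    intro m
    induction m with
    | zero => simp
    | succ m ih =>
      rw [List.range_succ, List.map_append, List.countP_append, ih, Nat.count_succ]
      simp
  -- The prefix stopping just before the argument of index `n + 1` (counted from `0`) contains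
  -- exactly `n + 1` arguments, one too many.
  have h1 := (h (Nat.nth (fun i => 2 ≤ s i) (n + 1))).2
  rw [hcount, Nat.count_nth_of_infinite hinf] at h1
  omega

/-! ### Finiteness of small positions in terms -/

namespace Term

variable {V : Type*} {t : Term V}

theorem label_of_concat {b : List ℕ} {k : ℕ} (h : t.label (b ++ [k]) ≠ none) :
    t.label b ≠ none := by
  rcases (t.child b k).1 h with ⟨⟨x, hx⟩, -⟩ | ⟨hx, -⟩ <;> simp [hx]

/-- A term of `Λ^001` has no infinite sequence of nested abstractions. -/
theorem Is001.exists_not_lam (h001 : t.Is001) (b : List ℕ) :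
    ∃ m : ℕ, ∀ x, t.label (b ++ List.replicate m 0) ≠ some (TermLabel.lam x) := by
  by_contra! h
  -- The default value `0` makes this sequence `b` followed by `0^ω`, a branch with no argument
  -- beyond `b`.
  have hinf := h001 (fun i => b.getD i 0) fun n => by
    obtain ⟨x, hx⟩ := h n
    have : (List.range n).map (fun i => b.getD i 0) <+: b ++ List.replicate n 0 := by
      have e : (List.range n).map (fun i => b.getD i 0) = (b ++ List.replicate n 0).take n := by
        apply List.ext_getElem
        · simp
        · intro i h1 h2
          simp only [List.length_map, List.length_range] at h1
          simp only [List.getElem_map, List.getElem_range, List.getElem_take, List.getElem_append,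
            List.getElem_replicate, List.getD_eq_getElem?_getD]
          split_ifs with hi
          · simp [hi]
          · simp [List.getElem?_eq_none (not_lt.1 hi)]
      rw [e]
      exact List.take_prefix _ _
    exact mem_of_prefix (A := {b | t.label b ≠ none}) (fun _ _ => label_of_concat) this
      (by simp [hx])
  refine hinf ((Set.finite_lt_nat b.length).subset fun i hi => ?_)
  by_contra hlt
  simp [List.getElem?_eq_none (not_lt.1 hlt)] at hi

/-- Collapsing preserves which tracks are arguments, so an infinite branch of small positions would
collapse to a branch of `t` with finitely many arguments. -/
theorem Is001.finite_small (h001 : t.Is001) {A : Set (List ℕ)} (hA : ∀ a k, a ++ [k] ∈ A → a ∈ A)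
    (hlab : ∀ a ∈ A, t.label (collapse a) ≠ none) (n : ℕ) : {a ∈ A | Small n a}.Finite := by
  refine finite_of_no_infinite_branch _ (fun a k h => ⟨hA a k h.1, h.2.of_append⟩) (n + 1)
    (fun a ha => ha.2.1) fun s => ?_
  by_contra! h
  have hinf := h001 (fun i => min (s i) 2) fun m => by
    have := hlab _ (h m).1
    simpa [collapse, Function.comp_def] using this
  exact hinf ((finite_of_small fun m => (h m).2).subset fun i hi => by
    simp only [Set.mem_ofPred_eq] at hi ⊢; omega)

end Term

/-! ### Truncation of types and decomposition of arrows -/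

namespace Ty

variable {X : Type*}

theorem label_of_concat {T : Ty X} {c : List ℕ} {k : ℕ} (h : T.label (c ++ [k]) ≠ none) :
    T.label c ≠ none := by
  simp [(T.child c k h).1]

/-- Tracks in a type are at least `1`, so an infinite branch with finitely many tracks `≥ 2` would
end by `1^ω`. -/
theorem finite_small (T : Ty X) (n : ℕ) : {c | T.label c ≠ none ∧ Small n c}.Finite := by
  refine finite_of_no_infinite_branch _ (fun a k h => ⟨label_of_concat h.1, h.2.of_append⟩) (n + 1)
    (fun a ha => ha.2.1) fun s => ?_
  by_contra! h
  obtain ⟨N, hN⟩ := (finite_of_small fun m => (h m).2).bddAbove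
  have h1 : ∀ i, N < i → s i = 1 := by
    intro i hi
    have hlt : ¬ 2 ≤ s i := fun h2 => absurd (hN h2) (by omega)
    have := (h (i + 1)).1
    rw [List.range_succ, List.map_append] at this
    have := (T.child _ _ this).2
    omega
  obtain ⟨j, hj⟩ := T.no_ones ((List.range (N + 1)).map s)
  have hrep : ∀ j, (List.range (N + 1 + j)).map s
      = (List.range (N + 1)).map s ++ List.replicate j 1 := by
    intro j
    induction j with
    | zero => simp
    | succ j ih =>
      rw [← Nat.add_assoc, List.range_succ, List.map_append, ih, List.replicate_succ']
      simp [h1 (N + 1 + j) (by omega)]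
  exact (h (N + 1 + j)).1 (hrep j ▸ hj)

/-- The restriction of a type to its small positions. -/
noncomputable def truncate (T : Ty X) (n : ℕ) : Ty X where
  label c := open Classical in if Small n c then T.label c else none
  root := by simpa [Small.nil] using T.root
  child := by
    intro c k h
    by_cases hs : Small n (c ++ [k])
    · simpa [hs.of_append] using T.child c k (by simpa [hs] using h)
    · simp [hs] at h
  target := by
    intro c h
    by_cases hs : Small n c
    · simpa [hs.concat le_rfl] using T.target c (by simpa [hs] using h)
    · simp [hs] at h
  no_ones := fun c => (T.no_ones c).imp fun m hm => by simp [hm]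

open Classical in
theorem truncate_label (T : Ty X) (n : ℕ) (c : List ℕ) :
    (T.truncate n).label c = if Small n c then T.label c else none := rfl

theorem finite_truncate (T : Ty X) (n : ℕ) : {c | (T.truncate n).label c ≠ none}.Finite := by
  refine (T.finite_small n).subset fun c hc => ?_
  by_cases hs : Small n c <;> simp_all [truncate_label]

@[simp] theorem arrow_label_nil (F : SeqTy X) (T : Ty X) :
    (arrow F T).label [] = some TyLabel.arrow := rfl

@[simp] theorem arrow_label_one (F : SeqTy X) (T : Ty X) (c : List ℕ) :
    (arrow F T).label (1 :: c) = T.label c := by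
  simp [arrow, arrowLabel]

theorem arrow_label_zero (F : SeqTy X) (T : Ty X) (c : List ℕ) :
    (arrow F T).label (0 :: c) = none := by
  simp [arrow, arrowLabel, SeqTy.label]

theorem arrow_label_arg (F : SeqTy X) (T : Ty X) {k : ℕ} (hk : 2 ≤ k) (c : List ℕ) :
    (arrow F T).label (k :: c) = (F ⟨k, hk⟩).bind fun S => S.label c := by
  have : k ≠ 1 := by omega
  simp [arrow, arrowLabel, SeqTy.label, this, hk]

/-- Every type has a symbol at its root, so absent tracks are visible in the labelled tree. -/
theorem arrow_injective {F F' : SeqTy X} {T T' : Ty X} (h : arrow F T = arrow F' T') :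
    F = F' ∧ T = T' := by
  constructor
  · funext ⟨k, hk⟩
    have hlab : ∀ c, ((F ⟨k, hk⟩).bind fun S => S.label c)
        = ((F' ⟨k, hk⟩).bind fun S => S.label c) := fun c => by
      rw [← arrow_label_arg F T hk, ← arrow_label_arg F' T' hk, h]
    cases hF : F ⟨k, hk⟩ with
    | none =>
      cases hF' : F' ⟨k, hk⟩ with
      | none => rfl
      | some S' => exact absurd (by simpa [hF, hF'] using (hlab []).symm) S'.root
    | some S =>
      cases hF' : F' ⟨k, hk⟩ with
      | none => exact absurd (by simpa [hF, hF'] using hlab []) S.root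
      | some S' =>
        congr 1
        exact Ty.ext (funext fun c => by simpa [hF, hF'] using hlab c)
  · exact Ty.ext (funext fun c => by rw [← arrow_label_one F T, h, arrow_label_one])

theorem eq_arrow {T U : Ty X} {F : SeqTy X} (h0 : T.label [] = some TyLabel.arrow)
    (h1 : ∀ c, T.label (1 :: c) = U.label c)
    (h2 : ∀ (k : ArgTrack) c, T.label (k.1 :: c) = (F k).bind fun S => S.label c) :
    T = arrow F U := by
  refine Ty.ext (funext fun c => ?_)
  rcases c with _ | ⟨k, c⟩
  · exact h0
  · rcases Nat.lt_or_ge k 2 with hk | hk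
    · interval_cases k
      · rw [arrow_label_zero]
        by_contra hne
        have hz : T.label ([] ++ [0]) ≠ none :=
          mem_of_prefix (A := {c | T.label c ≠ none}) (fun _ _ => label_of_concat)
            (by simp) hne
        exact absurd (T.child [] 0 hz).2 (by norm_num)
      · rw [h1, arrow_label_one]
    · rw [arrow_label_arg _ _ hk]
      exact h2 ⟨k, hk⟩ c

theorem var_ne_arrow (α : X) (F : SeqTy X) (T : Ty X) : var α ≠ arrow F T := fun h => by
  have := congrArg (fun T => T.label []) h
  simp [var] at this

end Ty

/-! ### Skeletons -/

variable {V X : Type*} {t : Term V}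

/-- The positions in `A` above `a` of the free occurrences of `x` in the subterm at `a`. -/
def freeLeaves (t : Term V) (A : Set (List ℕ)) (a : List ℕ) (x : V) : Set (List ℕ) :=
  {a' | a' ∈ A ∧ a <+: a' ∧ t.label (collapse a') = some (TermLabel.var x) ∧
    ∀ d : List ℕ, a <+: d → d <+: a' → t.label (collapse d) ≠ some (TermLabel.lam x)}

theorem freeLeaves_mono {A B : Set (List ℕ)} (h : A ⊆ B) {a : List ℕ} {x : V} :
    freeLeaves t A a x ⊆ freeLeaves t B a x :=
  fun _ h' => ⟨h h'.1, h'.2⟩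

/-- The data that determine a quantitative derivation typing a normal form: its support, its axiom
tracks and the types of its unconstrained positions. -/
structure Skeleton (X : Type*) (t : Term V) where
  supp : Set (List ℕ)
  root_mem : [] ∈ supp
  prefix_mem : ∀ (a : List ℕ) (k : ℕ), a ++ [k] ∈ supp → a ∈ supp
  label_ne : ∀ a ∈ supp, t.label (collapse a) ≠ none
  lam_mem : ∀ a ∈ supp, ∀ x, t.label (collapse a) = some (TermLabel.lam x) → a ++ [0] ∈ supp
  app_mem : ∀ a ∈ supp, t.label (collapse a) = some TermLabel.app → a ++ [1] ∈ supp
  track : List ℕ → ArgTrack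
  track_inj : ∀ a ∈ supp, ∀ x, Set.InjOn track (freeLeaves t supp a x)
  top : List ℕ → Ty X

/-- `a` is neither the left child of an application nor an abstraction. -/
def Unconstrained (t : Term V) (a : List ℕ) : Prop :=
  (∀ b, a ≠ b ++ [1]) ∧ ∀ x, t.label (collapse a) ≠ some (TermLabel.lam x)

namespace Skeleton

theorem child_label (S : Skeleton X t) {a : List ℕ} {k : ℕ} (h : a ++ [k] ∈ S.supp) :
    ((∃ x, t.label (collapse a) = some (TermLabel.lam x)) ∧ k = 0) ∨
      (t.label (collapse a) = some TermLabel.app ∧ 1 ≤ k) := by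
  have := S.label_ne _ h
  rw [collapse_concat] at this
  rcases (t.child _ _).1 this with ⟨h1, h2⟩ | ⟨h1, h2⟩
  · exact Or.inl ⟨h1, by omega⟩
  · exact Or.inr ⟨h1, by omega⟩

theorem mem_of_prefix (S : Skeleton X t) {a b : List ℕ} (h : a <+: b) (hb : b ∈ S.supp) :
    a ∈ S.supp :=
  RigidTyping.mem_of_prefix S.prefix_mem h hb

theorem left_label (S : Skeleton X t) {b : List ℕ} (h : b ++ [1] ∈ S.supp) :
    t.label (collapse b) = some TermLabel.app := by
  rcases S.child_label h with ⟨-, h⟩ | ⟨h, -⟩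
  · omega
  · exact h

theorem left_not_lam (S : Skeleton X t) (hnf : t.IsNormal) {b : List ℕ} (h : b ++ [1] ∈ S.supp)
    (x : V) : t.label (collapse (b ++ [1])) ≠ some (TermLabel.lam x) := fun hx =>
  hnf ⟨collapse b, x, S.left_label h, by simpa [collapse_concat] using hx⟩

/-- `S.Step a k a'`: the child `k` of the type at `a` is the type at `a'`. -/
inductive Step (S : Skeleton X t) : List ℕ → ℕ → List ℕ → Prop
  | target (b : List ℕ) : Step S (b ++ [1]) 1 b
  | arg (b : List ℕ) (k : ℕ) : 2 ≤ k → b ++ [k] ∈ S.supp → Step S (b ++ [1]) k (b ++ [k])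
  | body (a : List ℕ) (x : V) : t.label (collapse a) = some (TermLabel.lam x) →
      Step S a 1 (a ++ [0])
  | bound (a : List ℕ) (x : V) (a' : List ℕ) : t.label (collapse a) = some (TermLabel.lam x) →
      a' ∈ freeLeaves t S.supp (a ++ [0]) x → Step S a (S.track a').1 a'

variable (S : Skeleton X t)

theorem step_left (hnf : t.IsNormal) {b : List ℕ} (hb : b ++ [1] ∈ S.supp) {k : ℕ} {a' : List ℕ} :
    S.Step (b ++ [1]) k a' ↔ (k = 1 ∧ a' = b) ∨ (2 ≤ k ∧ b ++ [k] ∈ S.supp ∧ a' = b ++ [k]) := by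
  constructor
  · intro h
    generalize he : b ++ [1] = a at h
    cases h with
    | target b' => exact Or.inl ⟨rfl, (List.append_cancel_right he).symm⟩
    | arg b' k hk hm =>
      obtain rfl := List.append_cancel_right he
      exact Or.inr ⟨hk, hm, rfl⟩
    | body _ x hx => exact absurd (he ▸ hx) (S.left_not_lam hnf hb x)
    | bound _ x a' hx _ => exact absurd (he ▸ hx) (S.left_not_lam hnf hb x)
  · rintro (⟨rfl, rfl⟩ | ⟨hk, hm, rfl⟩)
    · exact Step.target _
    · exact Step.arg _ _ hk hm

theorem step_lam (hnf : t.IsNormal) {a : List ℕ} (ha : a ∈ S.supp) {x : V}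
    (hx : t.label (collapse a) = some (TermLabel.lam x)) {k : ℕ} {a' : List ℕ} :
    S.Step a k a' ↔ (k = 1 ∧ a' = a ++ [0]) ∨
      ((S.track a').1 = k ∧ a' ∈ freeLeaves t S.supp (a ++ [0]) x) := by
  constructor
  · intro h
    cases h with
    | target b' => exact absurd hx (S.left_not_lam hnf ha x)
    | arg b' k hk hm => exact absurd hx (S.left_not_lam hnf ha x)
    | body _ y hy => exact Or.inl ⟨rfl, rfl⟩
    | bound _ y a' hy hm =>
      obtain rfl : x = y := by simpa [hx] using hy
      exact Or.inr ⟨rfl, hm⟩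
  · rintro (⟨rfl, rfl⟩ | ⟨rfl, hm⟩)
    · exact Step.body _ _ hx
    · exact Step.bound _ _ _ hx hm

theorem exists_of_constrained {a : List ℕ} (h : ¬ Unconstrained t a) :
    (∃ b, a = b ++ [1]) ∨ ∃ x, t.label (collapse a) = some (TermLabel.lam x) := by
  by_contra! h'
  exact h h'

variable {S}

theorem Step.mem {a a' : List ℕ} {k : ℕ} (h : S.Step a k a') (ha : a ∈ S.supp) : a' ∈ S.supp := by
  cases h with
  | target b => exact S.prefix_mem _ _ ha
  | arg b k hk hm => exact hm
  | body _ x hx => exact S.lam_mem _ ha x hx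
  | bound _ x a' hx hm => exact hm.1

theorem Step.one_le {a a' : List ℕ} {k : ℕ} (h : S.Step a k a') : 1 ≤ k := by
  cases h with
  | target b => exact le_rfl
  | arg b k hk hm => omega
  | body _ x hx => exact le_rfl
  | bound _ x a' hx hm => have := (S.track a').2; omega

/-- Determinism makes the choice in `tyLabel` harmless. It combines normality, the separation of
track `1` from argument tracks, and the injectivity of axiom tracks. -/
theorem Step.unique (hnf : t.IsNormal) {a a₁ a₂ : List ℕ} {k : ℕ} (ha : a ∈ S.supp)
    (h₁ : S.Step a k a₁) (h₂ : S.Step a k a₂) : a₁ = a₂ := by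
  by_cases hl : ∃ b, a = b ++ [1]
  · obtain ⟨b, rfl⟩ := hl
    rw [S.step_left hnf ha] at h₁ h₂
    rcases h₁ with ⟨rfl, rfl⟩ | ⟨hk, -, rfl⟩ <;> rcases h₂ with ⟨hk', rfl⟩ | ⟨hk', -, rfl⟩ <;>
      first | rfl | omega
  · obtain ⟨x, hx⟩ : ∃ x, t.label (collapse a) = some (TermLabel.lam x) := by
      cases h₁ with
      | target b => exact absurd ⟨_, rfl⟩ hl
      | arg b k hk hm => exact absurd ⟨_, rfl⟩ hl
      | body _ x hx => exact ⟨x, hx⟩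
      | bound _ x a' hx hm => exact ⟨x, hx⟩
    rw [S.step_lam hnf ha hx] at h₁ h₂
    rcases h₁ with ⟨rfl, rfl⟩ | ⟨hk, hm⟩ <;> rcases h₂ with ⟨hk', rfl⟩ | ⟨hk', hm'⟩
    · rfl
    · have := (S.track a₂).2; omega
    · have := (S.track a₁).2; omega
    · exact S.track_inj _ (S.lam_mem _ ha _ hx) x hm hm' (Subtype.ext (hk.trans hk'.symm))

theorem exists_step_one {a : List ℕ} (h : ¬ Unconstrained t a) : ∃ a', S.Step a 1 a' := by
  rcases exists_of_constrained h with ⟨b, rfl⟩ | ⟨x, hx⟩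
  · exact ⟨_, Step.target b⟩
  · exact ⟨_, Step.body a x hx⟩

/-! ### Types and contexts read off a skeleton -/

variable (S)

open Classical in
/-- `S.tyLabel c a`: the symbol at position `c` of the type at `a`. -/
noncomputable def tyLabel : List ℕ → List ℕ → Option (TyLabel X)
  | [], a => if Unconstrained t a then (S.top a).label [] else some TyLabel.arrow
  | k :: c, a => if Unconstrained t a then (S.top a).label (k :: c)
      else if h : ∃ a', S.Step a k a' then tyLabel c h.choose else none

theorem tyLabel_unconstrained {a : List ℕ} (h : Unconstrained t a) (c : List ℕ) :
    S.tyLabel c a = (S.top a).label c := by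
  cases c <;> simp [tyLabel, h]

theorem tyLabel_nil {a : List ℕ} (h : ¬ Unconstrained t a) :
    S.tyLabel [] a = some TyLabel.arrow := by
  simp [tyLabel, h]

variable {S} in
theorem Step.tyLabel_cons (hnf : t.IsNormal) {a a' : List ℕ} {k : ℕ} (ha : a ∈ S.supp)
    (hu : ¬ Unconstrained t a) (h : S.Step a k a') (c : List ℕ) :
    S.tyLabel (k :: c) a = S.tyLabel c a' := by
  have hex : ∃ a', S.Step a k a' := ⟨a', h⟩
  rw [tyLabel, if_neg hu, dif_pos hex, hex.choose_spec.unique hnf ha h]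

theorem tyLabel_cons_eq_none {a : List ℕ} {k : ℕ} (hu : ¬ Unconstrained t a)
    (h : ∀ a', ¬ S.Step a k a') (c : List ℕ) : S.tyLabel (k :: c) a = none := by
  rw [tyLabel, if_neg hu, dif_neg (by simpa using h)]

/-- Case analysis on the symbols of the type at `a`. -/
theorem tyLabel_cases (hnf : t.IsNormal) {a : List ℕ} (ha : a ∈ S.supp) :
    (∀ c, S.tyLabel c a = (S.top a).label c) ∨
      (¬ Unconstrained t a ∧ S.tyLabel [] a = some TyLabel.arrow ∧
        ∀ k, (∃ a' ∈ S.supp, S.Step a k a' ∧ ∀ c, S.tyLabel (k :: c) a = S.tyLabel c a') ∨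
          ((∀ a', ¬ S.Step a k a') ∧ ∀ c, S.tyLabel (k :: c) a = none)) := by
  by_cases hu : Unconstrained t a
  · exact Or.inl (S.tyLabel_unconstrained hu)
  · refine Or.inr ⟨hu, S.tyLabel_nil hu, fun k => ?_⟩
    by_cases hk : ∃ a', S.Step a k a'
    · obtain ⟨a', h⟩ := hk
      exact Or.inl ⟨a', h.mem ha, h, h.tyLabel_cons hnf ha hu⟩
    · push Not at hk
      exact Or.inr ⟨hk, S.tyLabel_cons_eq_none hu hk⟩

theorem tyLabel_root (hnf : t.IsNormal) {a : List ℕ} (ha : a ∈ S.supp) :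
    S.tyLabel [] a ≠ none := by
  rcases S.tyLabel_cases hnf ha with h | ⟨-, h, -⟩
  · exact h [] ▸ (S.top a).root
  · simp [h]

theorem tyLabel_child (hnf : t.IsNormal) (c : List ℕ) (k : ℕ) {a : List ℕ} (ha : a ∈ S.supp)
    (h : S.tyLabel (c ++ [k]) a ≠ none) : S.tyLabel c a = some TyLabel.arrow ∧ 1 ≤ k := by
  induction c generalizing a with
  | nil =>
    rcases S.tyLabel_cases hnf ha with h' | ⟨-, h0, h'⟩
    · rw [h'] at h ⊢
      exact (S.top a).child [] k h
    · refine ⟨h0, ?_⟩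
      rcases h' k with ⟨a', -, hs, -⟩ | ⟨-, hn⟩
      · exact hs.one_le
      · exact absurd (hn []) h
  | cons j c ih =>
    rcases S.tyLabel_cases hnf ha with h' | ⟨-, h0, h'⟩
    · rw [h'] at h ⊢
      exact (S.top a).child _ k h
    · rcases h' j with ⟨a', ha', -, he⟩ | ⟨-, hn⟩
      · rw [he]
        exact ih ha' (by rw [← he]; exact h)
      · exact absurd (hn _) h

theorem tyLabel_target (hnf : t.IsNormal) (c : List ℕ) {a : List ℕ} (ha : a ∈ S.supp)
    (h : S.tyLabel c a = some TyLabel.arrow) : S.tyLabel (c ++ [1]) a ≠ none := by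
  induction c generalizing a with
  | nil =>
    rcases S.tyLabel_cases hnf ha with h' | ⟨hu, -, h'⟩
    · rw [h'] at h ⊢
      exact (S.top a).target [] h
    · obtain ⟨a', hs⟩ := exists_step_one (S := S) hu
      rw [List.nil_append, hs.tyLabel_cons hnf ha hu]
      exact S.tyLabel_root hnf (hs.mem ha)
  | cons j c ih =>
    rcases S.tyLabel_cases hnf ha with h' | ⟨-, h0, h'⟩
    · rw [h'] at h ⊢
      exact (S.top a).target _ h
    · rcases h' j with ⟨a', ha', -, he⟩ | ⟨-, hn⟩
      · rw [List.cons_append, he]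
        exact ih ha' (by rw [← he]; exact h)
      · simp [hn] at h

/-- Reading `1` repeatedly enters nested abstractions, of which there are finitely many, then
descends a left spine towards the root. It ends at an unconstrained position, whose given type has
no branch `1^ω`. -/
theorem tyLabel_ones (h001 : t.Is001) (hnf : t.IsNormal) {a : List ℕ} (ha : a ∈ S.supp) :
    ∃ n, S.tyLabel (List.replicate n 1) a = none := by
  -- The descent along the spine: the parent of a left child is an application, so no abstraction is
  -- met again.
  have key : ∀ a ∈ S.supp, (∀ x, t.label (collapse a) ≠ some (TermLabel.lam x)) →
      ∃ n, S.tyLabel (List.replicate n 1) a = none := by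
    intro a
    induction a using List.reverseRecOn with
    | nil =>
      intro _ hl
      obtain ⟨n, hn⟩ := (S.top []).no_ones []
      exact ⟨n, by rw [S.tyLabel_unconstrained ⟨by simp, hl⟩]; simpa using hn⟩
    | append_singleton b k ih =>
      intro ha hl
      by_cases hk : k = 1
      · subst hk
        obtain ⟨n, hn⟩ := ih (S.prefix_mem _ _ ha) (by simp [S.left_label ha])
        exact ⟨n + 1, by
          rw [List.replicate_succ, (Step.target b).tyLabel_cons hnf ha (by simp [Unconstrained]),
            hn]⟩
      · obtain ⟨n, hn⟩ := (S.top (b ++ [k])).no_ones []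
        refine ⟨n, ?_⟩
        rw [S.tyLabel_unconstrained ⟨?_, hl⟩]
        · simpa using hn
        · intro b' hb'
          exact hk (List.append_inj_right' hb' rfl |> List.singleton_inj.1)
  obtain ⟨m, hm⟩ := h001.exists_not_lam (collapse a)
  induction m generalizing a with
  | zero => exact key a ha (by simpa using hm)
  | succ m ih =>
    by_cases hl : ∃ x, t.label (collapse a) = some (TermLabel.lam x)
    · obtain ⟨x, hx⟩ := hl
      obtain ⟨n, hn⟩ := ih (S.lam_mem a ha x hx) (by
        simpa [collapse_concat, List.replicate_succ] using hm)
      exact ⟨n + 1, by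
        rw [List.replicate_succ, (Step.body a x hx).tyLabel_cons hnf ha
          (by simp [Unconstrained, hx]), hn]⟩
    · exact key a ha (by simpa using hl)

theorem tyLabel_no_ones (h001 : t.Is001) (hnf : t.IsNormal) (c : List ℕ) {a : List ℕ}
    (ha : a ∈ S.supp) : ∃ n, S.tyLabel (c ++ List.replicate n 1) a = none := by
  induction c generalizing a with
  | nil => exact S.tyLabel_ones h001 hnf ha
  | cons k c ih =>
    rcases S.tyLabel_cases hnf ha with h | ⟨-, -, h⟩
    · exact ((S.top a).no_ones (k :: c)).imp fun n hn => by rw [h, hn]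
    · rcases h k with ⟨a', ha', -, he⟩ | ⟨-, hn⟩
      · exact (ih ha').imp fun n hn => by rw [List.cons_append, he, hn]
      · exact ⟨0, hn _⟩

open Classical in
/-- The type at `a` in the derivation determined by a skeleton. -/
noncomputable def ty (h001 : t.Is001) (hnf : t.IsNormal) (a : List ℕ) : Ty X :=
  if ha : a ∈ S.supp then
    { label := fun c => S.tyLabel c a
      root := S.tyLabel_root hnf ha
      child := fun c k => S.tyLabel_child hnf c k ha
      target := fun c => S.tyLabel_target hnf c ha
      no_ones := fun c => S.tyLabel_no_ones h001 hnf c ha }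
  else S.top a

open Classical in
/-- The context at `a` in the derivation determined by a skeleton. -/
noncomputable def ctx (h001 : t.Is001) (hnf : t.IsNormal) (a : List ℕ) : Ctx V X := fun x k =>
  if h : ∃ a' ∈ freeLeaves t S.supp a x, S.track a' = k then some (S.ty h001 hnf h.choose)
  else none

/-! ### The typing rules for the reconstructed judgments -/

variable (h001 : t.Is001) (hnf : t.IsNormal)

theorem ty_label {a : List ℕ} (ha : a ∈ S.supp) (c : List ℕ) :
    (S.ty h001 hnf a).label c = S.tyLabel c a := by
  simp [ty, ha]

theorem ctx_of_mem {a a' : List ℕ} {x : V} (ha : a ∈ S.supp)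
    (h : a' ∈ freeLeaves t S.supp a x) :
    S.ctx h001 hnf a x (S.track a') = some (S.ty h001 hnf a') := by
  have hex : ∃ a'' ∈ freeLeaves t S.supp a x, S.track a'' = S.track a' := ⟨a', h, rfl⟩
  rw [ctx, dif_pos hex, S.track_inj a ha x hex.choose_spec.1 h hex.choose_spec.2]

theorem ctx_eq_none {a : List ℕ} {x : V} {k : ArgTrack}
    (h : ∀ a' ∈ freeLeaves t S.supp a x, S.track a' ≠ k) : S.ctx h001 hnf a x k = none := by
  rw [ctx, dif_neg (by simpa using h)]

theorem ctx_eq_some {a : List ℕ} (ha : a ∈ S.supp) {x : V} {k : ArgTrack} {U : Ty X} :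
    S.ctx h001 hnf a x k = some U ↔
      ∃ a' ∈ freeLeaves t S.supp a x, S.track a' = k ∧ S.ty h001 hnf a' = U := by
  constructor
  · intro h
    by_cases hex : ∃ a' ∈ freeLeaves t S.supp a x, S.track a' = k
    · obtain ⟨a', hm, rfl⟩ := hex
      exact ⟨a', hm, rfl, by simpa [S.ctx_of_mem h001 hnf ha hm] using h⟩
    · push Not at hex
      simp [S.ctx_eq_none h001 hnf hex] at h
  · rintro ⟨a', hm, rfl, rfl⟩
    exact S.ctx_of_mem h001 hnf ha hm

theorem ctx_ext {a : List ℕ} (ha : a ∈ S.supp) {x : V} {F : SeqTy X}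
    (h : ∀ k U, F k = some U ↔
      ∃ a' ∈ freeLeaves t S.supp a x, S.track a' = k ∧ S.ty h001 hnf a' = U) :
    S.ctx h001 hnf a x = F :=
  funext fun k => Option.ext fun U => by rw [S.ctx_eq_some h001 hnf ha, h]

open Classical in
theorem ty_left {b : List ℕ} (hb : b ++ [1] ∈ S.supp) :
    S.ty h001 hnf (b ++ [1]) = Ty.arrow
      (fun k => if b ++ [k.1] ∈ S.supp then some (S.ty h001 hnf (b ++ [k.1])) else none)
      (S.ty h001 hnf b) := by
  have hu : ¬ Unconstrained t (b ++ [1]) := by simp [Unconstrained]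
  apply Ty.eq_arrow
  · rw [S.ty_label _ _ hb, S.tyLabel_nil hu]
  · intro c
    rw [S.ty_label _ _ hb, S.ty_label _ _ (S.prefix_mem _ _ hb),
      (Step.target b).tyLabel_cons hnf hb hu]
  · intro k c
    rw [S.ty_label _ _ hb]
    by_cases hk : b ++ [k.1] ∈ S.supp
    · simp [hk, (Step.arg b k.1 k.2 hk).tyLabel_cons hnf hb hu, S.ty_label _ _ hk]
    · rw [S.tyLabel_cons_eq_none hu]
      · simp [hk]
      · intro a'
        rw [S.step_left hnf hb]
        have := k.2
        rintro (⟨h, -⟩ | ⟨-, h, -⟩)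
        · omega
        · exact hk h

theorem ty_lam {a : List ℕ} (ha : a ∈ S.supp) {x : V}
    (hx : t.label (collapse a) = some (TermLabel.lam x)) :
    S.ty h001 hnf a = Ty.arrow (S.ctx h001 hnf (a ++ [0]) x) (S.ty h001 hnf (a ++ [0])) := by
  have hu : ¬ Unconstrained t a := by simp [Unconstrained, hx]
  have ha0 := S.lam_mem a ha x hx
  apply Ty.eq_arrow
  · rw [S.ty_label _ _ ha, S.tyLabel_nil hu]
  · intro c
    rw [S.ty_label _ _ ha, S.ty_label _ _ ha0, (Step.body a x hx).tyLabel_cons hnf ha hu]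
  · intro k c
    rw [S.ty_label _ _ ha]
    by_cases hk : ∃ a' ∈ freeLeaves t S.supp (a ++ [0]) x, S.track a' = k
    · obtain ⟨a', hm, rfl⟩ := hk
      rw [(Step.bound a x a' hx hm).tyLabel_cons hnf ha hu, S.ctx_of_mem h001 hnf ha0 hm]
      simp [S.ty_label _ _ hm.1]
    · push Not at hk
      rw [S.tyLabel_cons_eq_none hu, S.ctx_eq_none h001 hnf hk]
      · rfl
      · intro a'
        rw [S.step_lam hnf ha hx]
        have := k.2
        rintro (⟨h, -⟩ | ⟨h, hm⟩)
        · omega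
        · exact hk a' hm (Subtype.ext h)

theorem freeLeaves_var {a : List ℕ} (ha : a ∈ S.supp) {x : V}
    (hx : t.label (collapse a) = some (TermLabel.var x)) (y : V) :
    freeLeaves t S.supp a y = {a' | a' = a ∧ y = x} := by
  ext a'
  constructor
  · rintro ⟨hm, ⟨c, rfl⟩, hl, -⟩
    rcases c with _ | ⟨k, c⟩
    · rw [List.append_nil, hx] at hl
      exact ⟨List.append_nil a, by simpa using hl.symm⟩
    · have := S.child_label (S.mem_of_prefix (a := a ++ [k]) ⟨c, by simp⟩ hm)
      simp [hx] at this
  · rintro ⟨rfl, rfl⟩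
    refine ⟨ha, List.prefix_rfl, hx, fun d h1 h2 => ?_⟩
    rw [← h1.eq_of_length_le h2.length_le, hx]
    simp

theorem freeLeaves_lam_self {a : List ℕ} {x : V}
    (hx : t.label (collapse a) = some (TermLabel.lam x)) :
    freeLeaves t S.supp a x = ∅ :=
  Set.eq_empty_of_forall_notMem fun _ h => h.2.2.2 a List.prefix_rfl h.2.1 hx

theorem mem_freeLeaves_child {a a' : List ℕ} {y : V}
    (h1 : t.label (collapse a) ≠ some (TermLabel.lam y))
    (h2 : t.label (collapse a) ≠ some (TermLabel.var y)) :
    a' ∈ freeLeaves t S.supp a y ↔ ∃ k, a' ∈ freeLeaves t S.supp (a ++ [k]) y := by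
  constructor
  · rintro ⟨hm, ⟨c, rfl⟩, hl, hd⟩
    rcases c with _ | ⟨k, c⟩
    · exact absurd (by simpa using hl) h2
    · exact ⟨k, hm, ⟨c, by simp⟩, hl, fun d hd1 => hd d ((List.prefix_append _ _).trans hd1)⟩
  · rintro ⟨k, hm, hp, hl, hd⟩
    refine ⟨hm, (List.prefix_append _ _).trans hp, hl, fun d h3 h4 => ?_⟩
    obtain ⟨c, rfl⟩ := h3
    rcases c with _ | ⟨j, c⟩
    · simpa using h1
    · refine hd _ ?_ h4
      exact List.prefix_of_prefix_length_le hp h4 (by simp)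

theorem freeLeaves_child_lam {a : List ℕ} {x y : V}
    (hx : t.label (collapse a) = some (TermLabel.lam x)) (hy : y ≠ x) :
    freeLeaves t S.supp a y = freeLeaves t S.supp (a ++ [0]) y := by
  ext a'
  rw [mem_freeLeaves_child S (by simpa [hx] using Ne.symm hy) (by simp [hx])]
  constructor
  · rintro ⟨k, hk⟩
    rcases S.child_label (S.mem_of_prefix hk.2.1 hk.1) with ⟨-, rfl⟩ | ⟨h, -⟩
    · exact hk
    · simp [hx] at h
  · exact fun h => ⟨0, h⟩

/-- The derivation determined by a skeleton. -/
noncomputable def toDeriv : Deriv X t where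
  supp := S.supp
  ctx := S.ctx h001 hnf
  ty := S.ty h001 hnf
  root_mem := S.root_mem
  prefix_mem := S.prefix_mem
  rule := by
    intro a ha
    unfold RuleAt
    rcases hl : t.label (collapse a) with _ | x | x | _
    · exact S.label_ne a ha hl
    · refine ⟨fun k hk => ?_, S.track a, funext fun y => ?_⟩
      · simpa [hl] using S.child_label hk
      · apply S.ctx_ext h001 hnf ha
        intro k U
        rw [S.freeLeaves_var ha hl]
        by_cases hy : y = x
        · by_cases hk : k = S.track a
          · simp [Ctx.single, SeqTy.single, hy, hk]
          · simp [Ctx.single, SeqTy.single, hy, hk, Ne.symm hk]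
        · simp [Ctx.single, SeqTy.empty, hy]
    · refine ⟨fun k => ⟨fun hk => ?_, ?_⟩, funext fun y => ?_, S.ty_lam h001 hnf ha hl⟩
      · simpa [hl] using S.child_label hk
      · rintro rfl
        exact S.lam_mem a ha x hl
      · apply S.ctx_ext h001 hnf ha
        intro k U
        by_cases hy : y = x
        · subst hy
          simp [S.freeLeaves_lam_self hl, Ctx.erase, SeqTy.empty]
        · rw [S.freeLeaves_child_lam hl hy]
          simp [Ctx.erase, hy, S.ctx_eq_some h001 hnf (S.lam_mem a ha x hl)]
    · have h1 := S.app_mem a ha hl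
      refine ⟨fun h0 => ?_, h1, ⟨_, S.ty_left h001 hnf h1, fun k U => ?_⟩, fun x => ⟨?_, ?_⟩⟩
      · simpa [hl] using S.child_label h0
      · simp
      · rintro ⟨i, hi⟩ ⟨j, hj⟩ hij
        refine Set.disjoint_left.2 fun k hki hkj => ?_
        obtain ⟨U, hU⟩ := Option.ne_none_iff_exists'.1 hki
        obtain ⟨U', hU'⟩ := Option.ne_none_iff_exists'.1 hkj
        obtain ⟨a₁, hm₁, rfl, -⟩ := (S.ctx_eq_some h001 hnf hi).1 hU
        obtain ⟨a₂, hm₂, ht, -⟩ := (S.ctx_eq_some h001 hnf hj).1 hU'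
        have hmem := fun a' => S.mem_freeLeaves_child (a := a) (a' := a') (y := x)
          (by simp [hl]) (by simp [hl])
        -- A track shared by two premises would come from a single leaf by injectivity at `a`; that
        -- leaf extends both premises, which therefore coincide.
        have := S.track_inj a ha x ((hmem _).2 ⟨_, hm₂⟩) ((hmem _).2 ⟨_, hm₁⟩) ht
        subst this
        have := List.prefix_of_prefix_length_le hm₁.2.1 hm₂.2.1 (by simp)
        have := this.eq_of_length (by simp)
        simp only [List.append_cancel_left_eq, List.cons.injEq, and_true] at this
        exact hij (Subtype.ext this)
      · intro k U
        rw [S.ctx_eq_some h001 hnf ha]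
        constructor
        · rintro ⟨a', hm, hk⟩
          obtain ⟨l, hl'⟩ := (S.mem_freeLeaves_child (by simp [hl]) (by simp [hl])).1 hm
          have hmem := S.mem_of_prefix hl'.2.1 hl'.1
          exact ⟨⟨l, hmem⟩, (S.ctx_eq_some h001 hnf hmem).2 ⟨a', hl', hk⟩⟩
        · rintro ⟨⟨l, hmem⟩, h⟩
          obtain ⟨a', hl', hk⟩ := (S.ctx_eq_some h001 hnf hmem).1 h
          exact ⟨a', (S.mem_freeLeaves_child (by simp [hl]) (by simp [hl])).2 ⟨l, hl'⟩, hk⟩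

end Skeleton

/-! ### Finite skeletons -/

/-- The longest prefix of `a` that does not end with `1`. -/
def spineTop (a : List ℕ) : List ℕ := a.rdropWhile (· == 1)

theorem spineTop_concat_one (b : List ℕ) : spineTop (b ++ [1]) = spineTop b :=
  List.rdropWhile_concat_pos _ _ _ (by simp)

theorem spineTop_concat (b : List ℕ) {k : ℕ} (hk : k ≠ 1) : spineTop (b ++ [k]) = b ++ [k] :=
  List.rdropWhile_concat_neg _ _ _ (by simpa using hk)

theorem length_spineTop_le (a : List ℕ) : (spineTop a).length ≤ a.length :=
  (List.rdropWhile_prefix _ _).length_le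

/-- Stripping trailing `1`s cannot cut into a prefix that ends with another track. -/
theorem prefix_spineTop {b a : List ℕ} {k : ℕ} (hk : k ≠ 1) (h : b ++ [k] <+: a) :
    b ++ [k] <+: spineTop a := by
  induction a using List.reverseRecOn with
  | nil => simp at h
  | append_singleton a j ih =>
    rcases List.prefix_concat_iff.1 h with h' | h'
    · rw [← h', spineTop_concat b hk]
    · by_cases hj : j = 1
      · subst hj
        rw [spineTop_concat_one]
        exact ih h'
      · rwa [spineTop_concat a hj]

namespace Skeleton

variable {S : Skeleton X t}

/-- Only `target` moves towards the root, and it stays on the same left spine; every other move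
reaches a spine that starts strictly higher in the tree. -/
theorem Step.spineTop_lt {a a' : List ℕ} {k : ℕ}
    (h : S.Step a k a') : (spineTop a).length < (spineTop a').length ∨
      spineTop a = spineTop a' ∧ a'.length < a.length := by
  cases h with
  | target => exact Or.inr ⟨spineTop_concat_one _, by simp⟩
  | arg b k hk hm =>
    left
    rw [spineTop_concat_one, spineTop_concat _ (by omega)]
    have := length_spineTop_le b
    simp; omega
  | body _ x hx =>
    left
    rw [spineTop_concat a (by omega)]
    have := length_spineTop_le a
    simp; omega
  | bound _ x a' hx hm =>
    left
    have h1 := (prefix_spineTop (by omega) hm.2.1).length_le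
    have := length_spineTop_le a
    simp at h1; omega

/-- In a finite support the start of a spine has bounded depth, so `spineTop_lt` gives a
well-founded lexicographic measure. -/
theorem Step.induction (hfin : S.supp.Finite) {p : List ℕ → Prop}
    (h : ∀ a ∈ S.supp, (∀ k a', S.Step a k a' → p a') → p a) {a : List ℕ} (ha : a ∈ S.supp) :
    p a := by
  obtain ⟨L, hL⟩ := (hfin.image List.length).bddAbove
  have hL : ∀ a ∈ S.supp, (spineTop a).length ≤ L := fun a ha =>
    (length_spineTop_le a).trans (hL ⟨a, ha, rfl⟩)
  induction hn : L - (spineTop a).length using Nat.strong_induction_on generalizing a with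
  | _ n ih =>
    induction hm : a.length using Nat.strong_induction_on generalizing a with
    | _ m ih' =>
      refine h a ha fun k a' hs => ?_
      have ha' := hs.mem ha
      rcases hs.spineTop_lt with hlt | ⟨he, hlt⟩
      · have := hL a' ha'
        exact ih _ (by omega) ha' rfl
      · exact ih' _ (by omega) ha' (by rw [← he, hn]) rfl

variable (S)

theorem finite_tyLabel (hnf : t.IsNormal) (hfin : S.supp.Finite)
    (htop : ∀ a ∈ S.supp, {c | (S.top a).label c ≠ none}.Finite) {a : List ℕ} (ha : a ∈ S.supp) :
    {c | S.tyLabel c a ≠ none}.Finite := by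
  refine Step.induction hfin (p := fun a => {c | S.tyLabel c a ≠ none}.Finite)
    (fun a ha ih => ?_) ha
  rcases S.tyLabel_cases hnf ha with h | ⟨hu, -, h⟩
  · simpa only [h] using htop a ha
  -- Finite branching: an available track is `1`, the axiom track of a position in the support, or
  -- the last entry of such a position.
  · have hK : {k | ∃ a', S.Step a k a'}.Finite := by
      refine (((Set.finite_singleton 1).union (hfin.image fun a' => (S.track a').1)).union
        (hfin.image fun a' => a'.getLastD 0)).subset ?_
      rintro k ⟨a', hs⟩
      have ha' := hs.mem ha
      cases hs with
      | target b => simp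
      | arg b k hk hm => exact Or.inr ⟨_, ha', by simp⟩
      | body _ x hx => simp
      | bound _ x a' hx hm => exact Or.inl (Or.inr ⟨_, ha', rfl⟩)
    refine ((Set.finite_singleton []).union (hK.biUnion
      (t := fun k => List.cons k '' {c | S.tyLabel (k :: c) a ≠ none}) fun k hk => ?_)).subset ?_
    · refine Set.Finite.image _ ?_
      rcases h k with ⟨a', -, hs, he⟩ | ⟨-, hn⟩
      · simpa only [he] using ih k a' hs
      · simp [hn]
    · rintro (_ | ⟨k, c⟩) hc
      · simp
      · right
        simp only [Set.mem_iUnion]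
        refine ⟨k, ?_, c, hc, rfl⟩
        rcases h k with ⟨a', -, hs, -⟩ | ⟨-, hn⟩
        · exact ⟨a', hs⟩
        · exact absurd (hn c) hc

variable (h001 : t.Is001) (hnf : t.IsNormal)

theorem toDeriv_label_right {a : List ℕ} (ha : a ∈ S.supp) (c : List ℕ) :
    (S.toDeriv h001 hnf).label (Bipos.right a c) = S.tyLabel c a :=
  S.ty_label h001 hnf ha c

theorem toDeriv_label_left {a a' : List ℕ} {x : V} (ha : a ∈ S.supp)
    (h : a' ∈ freeLeaves t S.supp a x) (c : List ℕ) :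
    (S.toDeriv h001 hnf).label (Bipos.left a x ((S.track a').1 :: c)) = S.tyLabel c a' := by
  have h2 := (S.track a').2
  simp [Deriv.label, toDeriv, SeqTy.label, h2, S.ctx_of_mem h001 hnf ha h, S.ty_label _ _ h.1]

theorem mem_bisupp_right {a c : List ℕ} :
    Bipos.right a c ∈ (S.toDeriv h001 hnf).bisupp ↔ a ∈ S.supp ∧ S.tyLabel c a ≠ none :=
  and_congr_right fun ha => by rw [← S.toDeriv_label_right h001 hnf ha c]; rfl

theorem mem_bisupp_left {a c : List ℕ} {x : V} :
    Bipos.left a x c ∈ (S.toDeriv h001 hnf).bisupp ↔ a ∈ S.supp ∧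
      ∃ a' ∈ freeLeaves t S.supp a x, ∃ d, c = (S.track a').1 :: d ∧ S.tyLabel d a' ≠ none := by
  refine and_congr_right fun ha => ⟨fun h => ?_, ?_⟩
  · rcases c with _ | ⟨k, d⟩
    · simp [SeqTy.label] at h
    · by_cases hk : 2 ≤ k
      · cases hc : S.ctx h001 hnf a x ⟨k, hk⟩ with
        | none => simp [SeqTy.label, toDeriv, hk, hc] at h
        | some U =>
          obtain ⟨a', hm, ht, rfl⟩ := (S.ctx_eq_some h001 hnf ha).1 hc
          refine ⟨a', hm, d, by simp [ht], ?_⟩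
          simpa [SeqTy.label, toDeriv, hk, hc, S.ty_label _ _ hm.1] using h
      · simp [SeqTy.label, hk] at h
  · rintro ⟨a', hm, d, rfl, hd⟩
    exact fun h => hd ((S.toDeriv_label_left h001 hnf ha hm d).symm.trans h)

theorem finite_bisupp (hfin : S.supp.Finite)
    (htop : ∀ a ∈ S.supp, {c | (S.top a).label c ≠ none}.Finite) :
    (S.toDeriv h001 hnf).bisupp.Finite := by
  have hty := fun a ha => S.finite_tyLabel hnf hfin htop (a := a) ha
  refine ((hfin.biUnion (t := fun a => Bipos.right a '' {c | S.tyLabel c a ≠ none})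
    fun a ha => (hty a ha).image _).union
    -- There may be infinitely many variables, but the leaf `a'` determines the one it types, so
    -- each innermost set has at most one element.
    (hfin.biUnion fun a ha => hfin.biUnion
      (t := fun a' => ⋃ c ∈ {c | S.tyLabel c a' ≠ none},
        {b | ∃ x, t.label (collapse a') = some (TermLabel.var x) ∧
          b = Bipos.left a x ((S.track a').1 :: c)})
      fun a' ha' => (hty a' ha').biUnion fun c _ => Set.Subsingleton.finite ?_)).subset ?_
  · rintro _ ⟨x, hx, rfl⟩ _ ⟨y, hy, rfl⟩
    obtain rfl : x = y := by simpa [hx] using hy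
    rfl
  · rintro (⟨a, c⟩ | ⟨a, x, c⟩) h
    · obtain ⟨ha, hc⟩ := (S.mem_bisupp_right h001 hnf).1 h
      left
      simp only [Set.mem_iUnion]
      exact ⟨a, ha, c, hc, rfl⟩
    · obtain ⟨ha, a', hm, d, rfl, hd⟩ := (S.mem_bisupp_left h001 hnf).1 h
      right
      simp only [Set.mem_iUnion]
      exact ⟨a, ha, a', hm.1, d, hd, x, hm.2.2.1, rfl⟩

/-! ### Approximability -/

/-- The restriction of a skeleton to its small positions. -/
noncomputable def restrict (n : ℕ) : Skeleton X t where
  supp := {a ∈ S.supp | Small n a}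
  root_mem := ⟨S.root_mem, Small.nil n⟩
  prefix_mem := fun a k h => ⟨S.prefix_mem a k h.1, h.2.of_append⟩
  label_ne := fun a h => S.label_ne a h.1
  lam_mem := fun a h x hx => ⟨S.lam_mem a h.1 x hx, h.2.concat (by norm_num)⟩
  app_mem := fun a h hx => ⟨S.app_mem a h.1 hx, h.2.concat le_rfl⟩
  track := S.track
  track_inj := fun a h x => (S.track_inj a h.1 x).mono (freeLeaves_mono fun _ h' => h'.1)
  top := fun a => (S.top a).truncate n

theorem mem_freeLeaves_restrict {n : ℕ} {a a' : List ℕ} {x : V} :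
    a' ∈ freeLeaves t (S.restrict n).supp a x ↔ a' ∈ freeLeaves t S.supp a x ∧ Small n a' := by
  simp only [freeLeaves, restrict, Set.mem_ofPred_eq]
  tauto

theorem step_restrict {n : ℕ} {a a' : List ℕ} {k : ℕ} (ha : a ∈ (S.restrict n).supp) :
    (S.restrict n).Step a k a' ↔ S.Step a k a' ∧ Small n a' := by
  constructor
  · intro h
    refine ⟨?_, (h.mem ha).2⟩
    cases h with
    | target => exact Step.target _
    | arg b k hk hm => exact Step.arg b k hk hm.1
    | body _ x hx => exact Step.body _ x hx
    | bound _ x a' hx hm => exact Step.bound a x a' hx (S.mem_freeLeaves_restrict.1 hm).1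
  · rintro ⟨h, hs⟩
    cases h with
    | target => exact Step.target _
    | arg b k hk hm => exact Step.arg b k hk ⟨hm, hs⟩
    | body _ x hx => exact Step.body _ x hx
    | bound _ x a' hx hm =>
      exact Step.bound (S := S.restrict n) a x a' hx (S.mem_freeLeaves_restrict.2 ⟨hm, hs⟩)

/-- Every move of the restricted skeleton is a move of `S` on the same track, so the two walks agree
as long as the restricted one continues. -/
theorem tyLabel_restrict (hnf : t.IsNormal) {n : ℕ} (c : List ℕ) {a : List ℕ} (ha : a ∈ (S.restrict n).supp)
    (h : (S.restrict n).tyLabel c a ≠ none) : (S.restrict n).tyLabel c a = S.tyLabel c a := by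
  induction c generalizing a with
  | nil =>
    by_cases hu : Unconstrained t a
    · rw [tyLabel_unconstrained _ hu, tyLabel_unconstrained _ hu]
      simp [restrict, Ty.truncate_label, Small.nil]
    · rw [tyLabel_nil _ hu, tyLabel_nil _ hu]
  | cons k c ih =>
    by_cases hu : Unconstrained t a
    · rw [tyLabel_unconstrained _ hu] at h ⊢
      rw [tyLabel_unconstrained _ hu]
      by_cases hs : Small n (k :: c)
      · simp [restrict, Ty.truncate_label, hs]
      · simp [restrict, Ty.truncate_label, hs] at h
    · by_cases hex : ∃ a', (S.restrict n).Step a k a'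
      · obtain ⟨a', hs⟩ := hex
        rw [hs.tyLabel_cons hnf ha hu] at h ⊢
        rw [((S.step_restrict ha).1 hs).1.tyLabel_cons hnf ha.1 hu]
        exact ih (hs.mem ha) h
      · push Not at hex
        exact absurd (tyLabel_cons_eq_none _ hu hex c) h

/-- The walk along `c` visits finitely many positions, each of them eventually small, and may finish
by reading a position of a free type that is eventually small too. -/
theorem eventually_tyLabel_restrict (hnf : t.IsNormal) (c : List ℕ) {a : List ℕ} (ha : a ∈ S.supp)
    (h : S.tyLabel c a ≠ none) :
    ∀ᶠ n in Filter.atTop, (S.restrict n).tyLabel c a ≠ none := by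
  induction c generalizing a with
  | nil =>
    filter_upwards [eventually_small a] with n hn
    exact tyLabel_root _ hnf (a := a) ⟨ha, hn⟩
  | cons k c ih =>
    by_cases hu : Unconstrained t a
    · filter_upwards [eventually_small (k :: c)] with n hn
      rw [tyLabel_unconstrained _ hu] at h ⊢
      simpa [restrict, Ty.truncate_label, hn] using h
    · by_cases hex : ∃ a', S.Step a k a'
      · obtain ⟨a', hs⟩ := hex
        rw [hs.tyLabel_cons hnf ha hu] at h
        filter_upwards [eventually_small a, eventually_small a', ih (hs.mem ha) h] with n h1 h2 h3
        have ha' : a ∈ (S.restrict n).supp := ⟨ha, h1⟩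
        rwa [((S.step_restrict ha').2 ⟨hs, h2⟩).tyLabel_cons hnf ha' hu]
      · push Not at hex
        exact absurd (tyLabel_cons_eq_none _ hu hex c) h

theorem isApprox_restrict (n : ℕ) :
    ((S.restrict n).toDeriv h001 hnf).IsApprox (S.toDeriv h001 hnf) := by
  have key : ∀ b ∈ ((S.restrict n).toDeriv h001 hnf).bisupp, b ∈ (S.toDeriv h001 hnf).bisupp ∧
      ((S.restrict n).toDeriv h001 hnf).label b = (S.toDeriv h001 hnf).label b := by
    rintro (⟨a, c⟩ | ⟨a, x, c⟩) h
    · obtain ⟨ha, hc⟩ := (mem_bisupp_right _ h001 hnf).1 h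
      have he := S.tyLabel_restrict hnf c ha hc
      rw [mem_bisupp_right, toDeriv_label_right _ _ _ ha, toDeriv_label_right _ _ _ ha.1, ← he]
      exact ⟨⟨ha.1, hc⟩, rfl⟩
    · obtain ⟨ha, a', hm, d, rfl, hd⟩ := (mem_bisupp_left _ h001 hnf).1 h
      have hm' := (S.mem_freeLeaves_restrict.1 hm).1
      have he := S.tyLabel_restrict hnf d hm.1 hd
      rw [toDeriv_label_left _ _ _ ha hm, he]
      exact ⟨(mem_bisupp_left _ h001 hnf).2 ⟨ha.1, a', hm', d, rfl, he ▸ hd⟩,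
        (toDeriv_label_left S h001 hnf ha.1 hm' d).symm⟩
  exact ⟨fun b hb => (key b hb).1, fun b hb => (key b hb).2⟩

theorem eventually_mem_bisupp_restrict {b : Bipos V} (hb : b ∈ (S.toDeriv h001 hnf).bisupp) :
    ∀ᶠ n in Filter.atTop, b ∈ ((S.restrict n).toDeriv h001 hnf).bisupp := by
  rcases b with ⟨a, c⟩ | ⟨a, x, c⟩
  · obtain ⟨ha, hc⟩ := (mem_bisupp_right _ h001 hnf).1 hb
    filter_upwards [eventually_small a, S.eventually_tyLabel_restrict hnf c ha hc] with n h1 h2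
    exact (mem_bisupp_right _ h001 hnf).2 ⟨⟨ha, h1⟩, h2⟩
  · obtain ⟨ha, a', hm, d, rfl, hd⟩ := (mem_bisupp_left _ h001 hnf).1 hb
    filter_upwards [eventually_small a, eventually_small a',
      S.eventually_tyLabel_restrict hnf d hm.1 hd] with n h1 h2 h3
    exact (mem_bisupp_left _ h001 hnf).2
      ⟨⟨ha, h1⟩, a', S.mem_freeLeaves_restrict.2 ⟨hm, h2⟩, d, rfl, h3⟩

/-- Finitely many eventual conditions hold for a common `n`. -/
theorem approximable : (S.toDeriv h001 hnf).Approximable := by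
  intro B hB hsub
  obtain ⟨n, hn⟩ := ((Filter.eventually_all_finite hB).2 fun b hb =>
    S.eventually_mem_bisupp_restrict h001 hnf (hsub hb)).exists
  exact ⟨(S.restrict n).toDeriv h001 hnf,
    finite_bisupp _ h001 hnf (h001.finite_small S.prefix_mem S.label_ne n)
      fun a _ => Ty.finite_truncate _ n,
    S.isApprox_restrict h001 hnf n, hn⟩

end Skeleton

/-! ### An unforgetful derivation -/

theorem Term.collapse_eq {a : List ℕ} (h : t.label a ≠ none) : collapse a = a := by
  induction a using List.reverseRecOn with
  | nil => rfl
  | append_singleton a k ih =>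
    rw [collapse_concat, ih (Term.label_of_concat h)]
    rcases (t.child a k).1 h with ⟨-, rfl⟩ | ⟨-, rfl | rfl⟩ <;> rfl

/-- The skeleton that types every argument exactly once. -/
def linearSkeleton (t : Term V) (α : X) : Skeleton X t where
  supp := {a | t.label a ≠ none}
  root_mem := t.root
  prefix_mem := fun _ _ => Term.label_of_concat
  label_ne := fun a h => by rwa [Term.collapse_eq h]
  lam_mem := fun a h x hx => by
    rw [Term.collapse_eq h] at hx
    exact (t.child a 0).2 (Or.inl ⟨⟨x, hx⟩, rfl⟩)
  app_mem := fun a h hx => by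
    rw [Term.collapse_eq h] at hx
    exact (t.child a 1).2 (Or.inr ⟨hx, Or.inl rfl⟩)
  -- Encoding positions gives distinct leaves distinct tracks, and the shift by `2` yields an
  -- argument track.
  track := fun a => ⟨Encodable.encode a + 2, by omega⟩
  track_inj := fun a _ x b _ c _ h => by simpa using h
  top := fun _ => Ty.var α

theorem linearSkeleton_left_mem {α : X} {b : List ℕ}
    (h : b ++ [1] ∈ (linearSkeleton t α).supp) : b ++ [2] ∈ (linearSkeleton t α).supp := by
  rcases (t.child b 1).1 h with ⟨-, h⟩ | ⟨h, -⟩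
  · omega
  · exact (t.child b 2).2 (Or.inr ⟨h, Or.inr rfl⟩)

/-- The polarity invariant. At a left child the source is nonempty, its members are types of
arguments, which are not left children, and the target types an application, which is not an
abstraction. At an abstraction the source consists of types of variable leaves, and the body is not
a left child. Since sources flip polarity, both implications carry through together. -/
theorem linearSkeleton_EFO (h001 : t.Is001) (hnf : t.IsNormal) {α : X} {s : Polarity} {T : Ty X}
    {c : List ℕ} (h : Ty.EFO s T c) {a : List ℕ} (ha : a ∈ (linearSkeleton t α).supp)
    (hT : (linearSkeleton t α).ty h001 hnf a = T) :
    (s = Polarity.neg → ∃ x, t.label (collapse a) = some (TermLabel.lam x)) ∧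
      (s = Polarity.pos → ∃ b, a = b ++ [1]) := by
  -- Unconstrained positions carry a type variable, so an arrow arises only at an abstraction or at
  -- a left child.
  have hcon : ∀ {F : SeqTy X} {U : Ty X} {a : List ℕ}, a ∈ (linearSkeleton t α).supp →
      (linearSkeleton t α).ty h001 hnf a = Ty.arrow F U →
      (∃ x, t.label (collapse a) = some (TermLabel.lam x) ∧
        F = (linearSkeleton t α).ctx h001 hnf (a ++ [0]) x ∧
        U = (linearSkeleton t α).ty h001 hnf (a ++ [0])) ∨
      (∃ b, a = b ++ [1] ∧
        (∀ k S, F k = some S ↔ b ++ [k.1] ∈ (linearSkeleton t α).supp ∧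
          (linearSkeleton t α).ty h001 hnf (b ++ [k.1]) = S) ∧
        U = (linearSkeleton t α).ty h001 hnf b) := by
    intro F U a ha he
    by_cases hu : Unconstrained t a
    · refine absurd ?_ (Ty.var_ne_arrow α F U)
      rw [← he]
      refine Ty.ext (funext fun c => ?_)
      rw [Skeleton.ty_label _ _ _ ha, Skeleton.tyLabel_unconstrained _ hu]
      rfl
    · rcases Skeleton.exists_of_constrained hu with ⟨b, rfl⟩ | ⟨x, hx⟩
      · rw [Skeleton.ty_left _ _ _ ha] at he
        obtain ⟨rfl, rfl⟩ := Ty.arrow_injective he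
        exact Or.inr ⟨b, rfl, by simp, rfl⟩
      · rw [Skeleton.ty_lam _ _ _ ha hx] at he
        obtain ⟨rfl, rfl⟩ := Ty.arrow_injective he
        exact Or.inl ⟨x, hx, rfl, rfl⟩
  induction h generalizing a with
  | here U =>
    refine ⟨fun _ => ?_, fun h => by cases h⟩
    rcases hcon ha hT with ⟨x, hx, -⟩ | ⟨b, rfl, hF, -⟩
    · exact ⟨x, hx⟩
    · have := (hF ⟨2, le_rfl⟩ _).2 ⟨linearSkeleton_left_mem ha, rfl⟩
      simp [SeqTy.empty] at this
  | target s F U c _ ih =>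
    rcases hcon ha hT with ⟨x, hx, -, hU⟩ | ⟨b, rfl, -, hU⟩
    · refine ⟨fun _ => ⟨x, hx⟩, fun hs => ?_⟩
      obtain ⟨b, hb⟩ := (ih (Skeleton.lam_mem _ a ha x hx) hU.symm).2 hs
      have := List.append_inj_right' hb rfl
      simp at this
    · refine ⟨fun hs => ?_, fun _ => ⟨b, rfl⟩⟩
      obtain ⟨x, hx⟩ := (ih (Skeleton.prefix_mem _ _ _ ha) hU.symm).1 hs
      simp [Skeleton.left_label _ ha] at hx
  | source s F U k W c hk _ ih =>
    rcases hcon ha hT with ⟨x, hx, rfl, -⟩ | ⟨b, rfl, hF, -⟩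
    · refine ⟨fun _ => ⟨x, hx⟩, ?_⟩
      rintro rfl
      obtain ⟨a', hm, -, hW⟩ := (Skeleton.ctx_eq_some _ h001 hnf
        (Skeleton.lam_mem _ a ha x hx)).1 hk
      obtain ⟨y, hy⟩ := (ih hm.1 hW).1 rfl
      simp [hm.2.2.1] at hy
    · refine ⟨?_, fun _ => ⟨b, rfl⟩⟩
      rintro rfl
      obtain ⟨hm, hW⟩ := (hF k W).1 hk
      obtain ⟨b', hb'⟩ := (ih hm hW).2 rfl
      have := List.append_inj_right' hb' rfl
      have h2 := k.2
      simp only [List.cons.injEq, and_true] at this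
      omega

theorem linearSkeleton_unforgetful (h001 : t.Is001) (hnf : t.IsNormal) (α : X) :
    ((linearSkeleton t α).toDeriv h001 hnf).Unforgetful := by
  constructor
  · rintro x c ⟨k, T, d, hk, -, hd⟩
    obtain ⟨a', hm, -, hT⟩ := (Skeleton.ctx_eq_some _ h001 hnf (Skeleton.root_mem _)).1 hk
    obtain ⟨y, hy⟩ := (linearSkeleton_EFO h001 hnf hd hm.1 hT).1 rfl
    simp [hm.2.2.1] at hy
  · intro c hc
    obtain ⟨b, hb⟩ := (linearSkeleton_EFO h001 hnf hc (Skeleton.root_mem _) rfl).2 rfl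
    simp at hb

/-! ### Quantitative derivations -/

namespace Deriv

theorem exists_hasAxTrack (P : Deriv X t) {a : List ℕ} {x : V} (ha : a ∈ P.supp)
    (hx : t.label (collapse a) = some (TermLabel.var x)) : ∃ k, P.HasAxTrack a x k := by
  have := P.rule a ha
  rw [RuleAt, hx] at this
  exact this.2

open Classical in
/-- The axiom track of the axiom leaf `a`. -/
noncomputable def axTrack (P : Deriv X t) (a : List ℕ) : ArgTrack :=
  -- The default track is arbitrary: skeletons consult tracks only at variable leaves of the
  -- support.
  if h : ∃ k x, P.HasAxTrack a x k then h.choose else ⟨2, le_rfl⟩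

theorem HasAxTrack.apply_eq_some {P : Deriv X t} {a : List ℕ} {x y : V} {k j : ArgTrack} {T : Ty X}
    (h : P.HasAxTrack a x k) : P.ctx a y j = some T ↔ y = x ∧ j = k ∧ P.ty a = T := by
  rw [h]
  by_cases hy : y = x <;> by_cases hj : j = k <;>
    simp [Ctx.single, SeqTy.single, SeqTy.empty, hy, hj]

theorem HasAxTrack.unique {P : Deriv X t} {a : List ℕ} {x y : V} {k j : ArgTrack}
    (h : P.HasAxTrack a x k) (h' : P.HasAxTrack a y j) : k = j :=
  (h'.apply_eq_some.1 (h.apply_eq_some.2 ⟨rfl, rfl, rfl⟩)).2.1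

theorem hasAxTrack_axTrack (P : Deriv X t) {a : List ℕ} {x : V} (ha : a ∈ P.supp)
    (hx : t.label (collapse a) = some (TermLabel.var x)) : P.HasAxTrack a x (P.axTrack a) := by
  obtain ⟨k, hk⟩ := P.exists_hasAxTrack ha hx
  have hex : ∃ k x, P.HasAxTrack a x k := ⟨k, x, hk⟩
  obtain ⟨y, hy⟩ := hex.choose_spec
  rw [axTrack, dif_pos hex, ← hk.unique hy]
  exact hk

/-- Two leaves sharing a track would contribute singletons with the same root to a disjoint join. -/
theorem Quantitative.axTrack_inj {P : Deriv X t} (hP : P.Quantitative) {a : List ℕ}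
    (ha : a ∈ P.supp) (x : V) : Set.InjOn P.axTrack (freeLeaves t P.supp a x) := by
  intro b hb c hc hbc
  by_contra hne
  have := (hP a ha x).1 ⟨(b, P.axTrack b), hb, P.hasAxTrack_axTrack hb.1 hb.2.2.1⟩
    ⟨(c, P.axTrack c), hc, P.hasAxTrack_axTrack hc.1 hc.2.2.1⟩ (by simp [hne])
  exact Set.disjoint_left.1 this (show P.axTrack b ∈ _ by simp [SeqTy.roots, SeqTy.single])
    (by simp [SeqTy.roots, SeqTy.single, hbc])

theorem Quantitative.ctx_eq_some {P : Deriv X t} (hP : P.Quantitative) {a : List ℕ}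
    (ha : a ∈ P.supp) {x : V} {k : ArgTrack} {T : Ty X} : P.ctx a x k = some T ↔
      ∃ a' ∈ freeLeaves t P.supp a x, P.axTrack a' = k ∧ P.ty a' = T := by
  rw [(hP a ha x).2 k T]
  constructor
  · rintro ⟨⟨⟨a', j⟩, hm, hj⟩, h⟩
    by_cases hk : k = j
    · refine ⟨a', hm, ?_, by simpa [SeqTy.single, hk] using h⟩
      rw [hk]
      exact (P.hasAxTrack_axTrack hm.1 hm.2.2.1).unique hj
    · simp [SeqTy.single, hk] at h
  · rintro ⟨a', hm, rfl, rfl⟩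
    exact ⟨⟨(a', P.axTrack a'), hm, P.hasAxTrack_axTrack hm.1 hm.2.2.1⟩, by simp [SeqTy.single]⟩

theorem rule_lam (P : Deriv X t) {a : List ℕ} (ha : a ∈ P.supp) {x : V}
    (hx : t.label (collapse a) = some (TermLabel.lam x)) :
    a ++ [0] ∈ P.supp ∧ P.ty a = Ty.arrow (P.ctx (a ++ [0]) x) (P.ty (a ++ [0])) := by
  have := P.rule a ha
  rw [RuleAt, hx] at this
  exact ⟨(this.1 0).2 rfl, this.2.2⟩

theorem rule_app (P : Deriv X t) {a : List ℕ} (ha : a ∈ P.supp)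
    (hx : t.label (collapse a) = some TermLabel.app) :
    a ++ [1] ∈ P.supp ∧ ∃ S : SeqTy X, P.ty (a ++ [1]) = Ty.arrow S (P.ty a) ∧
      ∀ (k : ArgTrack) (U : Ty X), S k = some U ↔ a ++ [k.1] ∈ P.supp ∧ P.ty (a ++ [k.1]) = U := by
  have := P.rule a ha
  rw [RuleAt, hx] at this
  exact ⟨this.2.1, this.2.2.1⟩

/-- The skeleton of a quantitative derivation. -/
noncomputable def Quantitative.skeleton {P : Deriv X t} (hP : P.Quantitative) : Skeleton X t where
  supp := P.supp
  root_mem := P.root_mem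
  prefix_mem := P.prefix_mem
  label_ne := fun a ha h => by
    have := P.rule a ha
    rwa [RuleAt, h] at this
  lam_mem := fun a ha x hx => (P.rule_lam ha hx).1
  app_mem := fun a ha hx => (P.rule_app ha hx).1
  track := P.axTrack
  track_inj := fun a ha => hP.axTrack_inj ha
  -- On the support, only the values at unconstrained positions enter the reconstruction.
  top := P.ty

/-- The typing rules and quantitativity make the types of `P` obey the recursion that defines
`tyLabel`, so induction on the type position identifies the two. -/
theorem Quantitative.skeleton_tyLabel {P : Deriv X t} (hP : P.Quantitative) (hnf : t.IsNormal)
    (c : List ℕ) {a : List ℕ} (ha : a ∈ P.supp) : hP.skeleton.tyLabel c a = (P.ty a).label c := by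
  induction c generalizing a with
  | nil =>
    by_cases hu : Unconstrained t a
    · exact Skeleton.tyLabel_unconstrained _ hu []
    · rw [Skeleton.tyLabel_nil _ hu]
      rcases Skeleton.exists_of_constrained hu with ⟨b, rfl⟩ | ⟨x, hx⟩
      · obtain ⟨-, S, h, -⟩ := P.rule_app (P.prefix_mem _ _ ha) (hP.skeleton.left_label ha)
        simp [h]
      · simp [(P.rule_lam ha hx).2]
  | cons k c ih =>
    by_cases hu : Unconstrained t a
    · exact Skeleton.tyLabel_unconstrained _ hu _
    have hstep : ∀ a', hP.skeleton.Step a k a' → (P.ty a).label (k :: c) = (P.ty a').label c := by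
      intro a' hs
      cases hs with
      | target =>
        obtain ⟨-, S, h, -⟩ := P.rule_app (P.prefix_mem _ _ ha) (hP.skeleton.left_label ha)
        simp [h]
      | arg b k hk hm =>
        obtain ⟨-, S, h, hS⟩ := P.rule_app (P.prefix_mem _ _ ha) (hP.skeleton.left_label ha)
        rw [h, Ty.arrow_label_arg _ _ hk, (hS ⟨k, hk⟩ _).2 ⟨hm, rfl⟩]
        rfl
      | body _ x hx => simp [(P.rule_lam ha hx).2]
      | bound _ x a' hx hm =>
        have hc := (hP.ctx_eq_some (P.rule_lam ha hx).1).2 ⟨a', hm, rfl, rfl⟩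
        rw [(P.rule_lam ha hx).2, Ty.arrow_label_arg _ _ (hP.skeleton.track a').2]
        exact congrArg (fun o => Option.bind o fun S => S.label c) hc
    by_cases hex : ∃ a', hP.skeleton.Step a k a'
    · obtain ⟨a', hs⟩ := hex
      rw [hs.tyLabel_cons hnf ha hu, hstep a' hs, ih (hs.mem ha)]
    -- Without a move on track `k` the type in `P` must have no child `k`: track `0` never occurs,
    -- track `1` always has a move, and a source member on a track `≥ 2` would come from an argument
    -- or a bound leaf, hence give a move.
    · push Not at hex
      rw [Skeleton.tyLabel_cons_eq_none _ hu hex]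
      rcases Nat.lt_or_ge k 2 with hk | hk
      · interval_cases k
        · rcases Skeleton.exists_of_constrained hu with ⟨b, rfl⟩ | ⟨x, hx⟩
          · obtain ⟨-, S, h, -⟩ := P.rule_app (P.prefix_mem _ _ ha) (hP.skeleton.left_label ha)
            rw [h, Ty.arrow_label_zero]
          · rw [(P.rule_lam ha hx).2, Ty.arrow_label_zero]
        · obtain ⟨a', hs⟩ := Skeleton.exists_step_one (S := hP.skeleton) hu
          exact absurd hs (hex a')
      · rcases Skeleton.exists_of_constrained hu with ⟨b, rfl⟩ | ⟨x, hx⟩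
        · obtain ⟨-, S, h, hS⟩ := P.rule_app (P.prefix_mem _ _ ha) (hP.skeleton.left_label ha)
          rw [h, Ty.arrow_label_arg _ _ hk]
          cases hSk : S ⟨k, hk⟩ with
          | none => rfl
          | some U => exact absurd (Skeleton.Step.arg b k hk ((hS _ _).1 hSk).1) (hex _)
        · rw [(P.rule_lam ha hx).2, Ty.arrow_label_arg _ _ hk]
          cases hck : P.ctx (a ++ [0]) x ⟨k, hk⟩ with
          | none => rfl
          | some U =>
            obtain ⟨a', hm, ht, -⟩ := (hP.ctx_eq_some (P.rule_lam ha hx).1).1 hck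
            have hs : hP.skeleton.Step a (P.axTrack a').1 a' := Skeleton.Step.bound a x a' hx hm
            rw [ht] at hs
            exact absurd hs (hex a')

theorem Quantitative.skeleton_ty {P : Deriv X t} (hP : P.Quantitative) (h001 : t.Is001)
    (hnf : t.IsNormal) {a : List ℕ} (ha : a ∈ P.supp) : hP.skeleton.ty h001 hnf a = P.ty a :=
  Ty.ext (funext fun c => by rw [Skeleton.ty_label _ _ _ ha, hP.skeleton_tyLabel hnf c ha])

theorem Quantitative.skeleton_ctx {P : Deriv X t} (hP : P.Quantitative) (h001 : t.Is001)
    (hnf : t.IsNormal) {a : List ℕ} (ha : a ∈ P.supp) (x : V) :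
    hP.skeleton.ctx h001 hnf a x = P.ctx a x := by
  refine Skeleton.ctx_ext _ h001 hnf ha fun k U => (hP.ctx_eq_some ha).trans ?_
  refine exists_congr fun a' => and_congr_right fun hm => ?_
  rw [hP.skeleton_ty h001 hnf hm.1]
  rfl

/-- Approximability only depends on the symbols of a derivation on its support. -/
theorem Approximable.congr {P Q : Deriv X t} (hQ : Q.Approximable) (hs : Q.supp = P.supp)
    (hty : ∀ a ∈ P.supp, Q.ty a = P.ty a) (hctx : ∀ a ∈ P.supp, ∀ x, Q.ctx a x = P.ctx a x) :
    P.Approximable := by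
  have hb : Q.bisupp = P.bisupp := by
    ext (⟨a, c⟩ | ⟨a, x, c⟩)
    · exact ⟨fun h => ⟨hs ▸ h.1, hty a (hs ▸ h.1) ▸ h.2⟩, fun h => ⟨hs ▸ h.1, (hty a h.1).symm ▸ h.2⟩⟩
    · exact ⟨fun h => ⟨hs ▸ h.1, hctx a (hs ▸ h.1) x ▸ h.2⟩,
        fun h => ⟨hs ▸ h.1, (hctx a h.1 x).symm ▸ h.2⟩⟩
  have hl : ∀ b ∈ P.bisupp, Q.label b = P.label b := by
    rintro (⟨a, c⟩ | ⟨a, x, c⟩) h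
    · simp [label, hty a h.1]
    · simp [label, hctx a h.1 x]
  intro B hB hsub
  obtain ⟨P₀, hfin, happ, hBP⟩ := hQ B hB (hb ▸ hsub)
  exact ⟨P₀, hfin, ⟨hb ▸ happ.1, fun b h => (happ.2 b h).trans (hl b (hb ▸ happ.1 h))⟩, hBP⟩

theorem Quantitative.approximable {P : Deriv X t} (hP : P.Quantitative) (h001 : t.Is001)
    (hnf : t.IsNormal) : P.Approximable :=
  (hP.skeleton.approximable h001 hnf).congr rfl (fun _ ha => hP.skeleton_ty h001 hnf ha)
    fun _ ha x => hP.skeleton_ctx h001 hnf ha x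

end Deriv

end RigidTyping

theorem mainTheorem5 {V X : Type*} [Nonempty X] (t : RigidTyping.Term V)
    (h001 : t.Is001) (hnf : t.IsNormal) :
    (∃ P : RigidTyping.Deriv X t, P.Approximable ∧ P.Unforgetful) ∧
      ∀ P : RigidTyping.Deriv X t, P.Quantitative → P.Approximable := by
  obtain ⟨α⟩ := ‹Nonempty X›
  exact ⟨⟨_, RigidTyping.Skeleton.approximable _ h001 hnf,
    RigidTyping.linearSkeleton_unforgetful h001 hnf α⟩, fun P hP => hP.approximable h001 hnf⟩
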